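/- Let $R$ be a complete discrete valuation ring with normalized valuation $v$, fraction field $K$, and perfect residue field of characteristic $p>0$. Let $E/K$ be an elliptic curve with potentially good reduction which admits a $K$-rational isogeny of prime degree $\ell>3$, i.e. an isogeny $E\to E'$ of degree $\ell$ defined over $K$ to some elliptic curve $E'/K$, and suppose that $\ell\neq p$. Denote by $\Delta_{E/K}$ the discriminant of a minimal Weierstrass equation for $E/K$. Then $$12 \ \text{ divides } \ (\ell-1)\,v(\Delta_{E/K}).$$ -/

import Mathlib

open Polynomial
open scoped Polynomial.Bivariate

noncomputable section

namespace WeierstrassCurve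

universe u v

section Isogeny

variable {K : Type v} [Field K]

/-- The coordinate function `x` in the function field `K(E)` of a Weierstrass curve `E` over `K`. -/
def xFun (E : WeierstrassCurve K) : E.toAffine.FunctionField :=
  algebraMap E.toAffine.CoordinateRing E.toAffine.FunctionField
    (Affine.CoordinateRing.mk E.toAffine (C X))

/-- The coordinate function `y` in the function field `K(E)` of a Weierstrass curve `E` over `K`. -/
def yFun (E : WeierstrassCurve K) : E.toAffine.FunctionField :=
  algebraMap E.toAffine.CoordinateRing E.toAffine.FunctionField
    (Affine.CoordinateRing.mk E.toAffine Y)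

/-- The function `f` in `K(E)` is regular at the affine point `(x, y)` of `E`, whose coordinates
lie in an algebraic closure of `K`, and takes the value `c` there: `f` is a quotient `a / b` of
polynomials in the coordinate functions with coefficients in `K`, such that `b(x, y) ≠ 0` and
`a(x, y) / b(x, y) = c`. -/
def HasValueAt (E : WeierstrassCurve K) (f : E.toAffine.FunctionField)
    (x y c : AlgebraicClosure K) : Prop :=
  ∃ a b : K[X][Y],
    aevalAeval x y b ≠ 0 ∧
    f * algebraMap E.toAffine.CoordinateRing E.toAffine.FunctionField
        (Affine.CoordinateRing.mk E.toAffine b) =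
      algebraMap E.toAffine.CoordinateRing E.toAffine.FunctionField
        (Affine.CoordinateRing.mk E.toAffine a) ∧
    aevalAeval x y a / aevalAeval x y b = c

/-- The rational map `E ⇢ E'` over `K` with pullback `f : K(E') → K(E)` takes the affine
point `(x, y)` of `E` to the given geometric point of `E'`: to an affine point `(x', y')` if the
pullbacks of the two coordinate functions of `E'` are regular at `(x, y)` with values `x'` and `y'`,
and to the point at infinity if the pullback of the function `1 / x` on `E'` vanishes
at `(x, y)`. -/
def SendsTo (E E' : WeierstrassCurve K)
    (f : E'.toAffine.FunctionField →ₐ[K] E.toAffine.FunctionField)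
    (x y : AlgebraicClosure K) : (E'.baseChange (AlgebraicClosure K)).toAffine.Point → Prop
  | .zero => E.HasValueAt (f E'.xFun)⁻¹ x y 0
  | .some x' y' _ => E.HasValueAt (f E'.xFun) x y x' ∧ E.HasValueAt (f E'.yFun) x y y'

open scoped Classical in
/-- A `K`-rational isogeny `E → E'` of elliptic curves over `K`: a nonconstant morphism of curves
over `K`, represented by its pullback `K(E') → K(E)` on function fields (nonconstant since `K(E')`
embeds in `K(E)`), which induces a homomorphism of groups on the points over an algebraic closure
of `K`. -/
structure Isogeny (E E' : WeierstrassCurve K) where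
  /-- The pullback of rational functions. -/
  comap : E'.toAffine.FunctionField →ₐ[K] E.toAffine.FunctionField
  /-- The homomorphism on geometric points. -/
  toHom : (E.baseChange (AlgebraicClosure K)).toAffine.Point →+
    (E'.baseChange (AlgebraicClosure K)).toAffine.Point
  sendsTo : ∀ (x y : AlgebraicClosure K)
    (h : (E.baseChange (AlgebraicClosure K)).toAffine.Nonsingular x y),
    SendsTo E E' comap x y (toHom (.some x y h))

/-- The degree of the field extension `L` of the image of `F` under a `K`-embedding `f : F → L`
(with the convention that it is `0` if that degree is infinite). -/
def extensionDegree {K F L : Type*} [Field K] [Field F] [Field L] [Algebra K F] [Algebra K L]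
    (f : F →ₐ[K] L) : ℕ :=
  Module.finrank f.fieldRange L

/-- The degree of an isogeny `E → E'`, i.e. the degree of the field extension of `K(E)` over the
image of `K(E')`. -/
def Isogeny.degree {E E' : WeierstrassCurve K} (φ : Isogeny E E') : ℕ :=
  extensionDegree φ.comap

end Isogeny

section Reduction

variable (R : Type u) [CommRing R] [IsDomain R] [IsDiscreteValuationRing R]
variable {K : Type v} [Field K] [Algebra R K] [IsFractionRing R K]

/-- The normalized additive valuation `v(Δ)` of the discriminant of a Weierstrass equation with
nonzero discriminant over the fraction field of the discrete valuation ring `R`. -/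
def valΔ (W : WeierstrassCurve K) : ℤ :=
  -WithZero.log ((IsDiscreteValuationRing.maximalIdeal R).valuation K W.Δ)

/-- For a complete discrete valuation ring `R` with fraction field `K`, an elliptic curve `E` over
`K` has potentially good reduction if there is a finite extension `L` of `K` such that `E` has good
reduction over `L`, i.e. some Weierstrass equation of the base change of `E` to `L` is minimal with
unit discriminant, over the integral closure of `R` in `L` (which is a discrete valuation ring with
fraction field `L`, as `R` is complete). -/
def HasPotentiallyGoodReduction (E : WeierstrassCurve K) : Prop :=
  ∃ (L : IntermediateField K (AlgebraicClosure K)) (_ : FiniteDimensional K L)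
    (_ : IsDiscreteValuationRing (integralClosure R L))
    (_ : IsFractionRing (integralClosure R L) L)
    (C : VariableChange L),
    HasGoodReduction (integralClosure R L) (C • E.baseChange L)

end Reduction

end WeierstrassCurve

end

/-! Let `P` be a nonzero point of the kernel and put `δ(P) = x(2P) - x(P)`, which equals `-ψ₃/ψ₂²`
evaluated at `x(P)`. Over a valuation ring `O` of the algebraic closure dominating `R`, the curve
has a model with unit discriminant. There the multiples of `P` have integral `x`-coordinates,
because the kernel of reduction has no `ℓ`-torsion for `ℓ ≠ p`, and `δ(P)` is a unit. A change of
variables scales `δ` by `u²` and `Δ` by `u¹²`, so `δ(P)⁶` and `Δ` have the same valuation on the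
original equation (`valuation_threeDiv_div_twoDiv`).

The kernel has `ℓ` geometric points, all separable (`card_ker_and_ker_le`), hence `n = (ℓ - 1)/2`
nonzero `x`-coordinates, permuted by Galois. The product `N` of `ψ₃/ψ₂²` over them lies in `K`
(`prod_aroots_mem_range`), and `6 v(N) = n v(Δ)`. Doubling gives `(ℓ - 1) v(Δ) = 12 v(N)`, and
passing to another Weierstrass equation changes `v(Δ)` by a multiple of 12.

The kernel is reached through `x` alone: an isogeny commutes with negation, so it acts on `x` by a
rational function `u/w`, whose degree is that of the isogeny. -/

noncomputable section

namespace WeierstrassCurve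

/-! ### Division polynomials and addition formulas in terms of `x` -/

section DivisionValues

variable {R : Type*} [CommRing R] (W : WeierstrassCurve R)

/-- The value at `x` of the square of the `2`-division polynomial. -/
def twoDiv (x : R) : R := 4 * x ^ 3 + W.b₂ * x ^ 2 + 2 * W.b₄ * x + W.b₆

/-- The value at `x` of the `3`-division polynomial. -/
def threeDiv (x : R) : R :=
  3 * x ^ 4 + W.b₂ * x ^ 3 + 3 * W.b₄ * x ^ 2 + 3 * W.b₆ * x + W.b₈

/-- This places `Δ` in the ideal generated by the two values. Once `threeDiv` is a multiple of
`twoDiv`, it follows that `twoDiv` divides `Δ`. -/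
lemma Δ_eq_twoDiv_threeDiv (x : R) :
    W.Δ = W.twoDiv x * ((W.b₂ + 12 * x) * (W.b₄ + W.b₂ * x + 6 * x ^ 2) - 27 * W.twoDiv x) +
      W.threeDiv x * (32 * (W.b₄ + W.b₂ * x + 6 * x ^ 2) - (W.b₂ + 12 * x) ^ 2) := by
  simp only [twoDiv, threeDiv, Δ]
  linear_combination (-8 * W.b₄ - 2 * W.b₂ * x - 12 * x ^ 2) * W.b_relation

lemma twoDiv_map {S : Type*} [CommRing S] (f : R →+* S) (x : R) :
    (W.map f).twoDiv (f x) = f (W.twoDiv x) := by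
  simp [twoDiv, map_ofNat f]

lemma threeDiv_map {S : Type*} [CommRing S] (f : R →+* S) (x : R) :
    (W.map f).threeDiv (f x) = f (W.threeDiv x) := by
  simp [threeDiv, map_ofNat f]

end DivisionValues

namespace Affine.Point

variable {F : Type*} [Field F] {W : Affine F}

/-- The `x`-coordinate of a point, with value `0` at the point at infinity. -/
def xCoord : W.Point → F
  | .zero => 0
  | .some x _ _ => x

@[simp]
lemma xCoord_some {x y : F} (h : W.Nonsingular x y) : (some x y h).xCoord = x := rfl

@[simp]
lemma xCoord_neg (P : W.Point) : (-P).xCoord = P.xCoord := by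
  rcases P with _ | _ <;> rfl

lemma eq_or_eq_neg_of_xCoord_eq {P Q : W.Point} (hP : P ≠ 0) (hQ : Q ≠ 0)
    (h : P.xCoord = Q.xCoord) : P = Q ∨ P = -Q := by
  rcases P with _ | ⟨x₁, y₁, h₁⟩
  · exact absurd rfl hP
  rcases Q with _ | ⟨x₂, y₂, h₂⟩
  · exact absurd rfl hQ
  exact X_eq_iff.mp h

/-- The left side is invariant under negating `Q`, so the `y`-coordinates can be eliminated by the
two Weierstrass equations. With `P` replaced by `nP` and `Q` by `P` it becomes a recurrence for
`x(nP)`. -/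
lemma xCoord_add_add_xCoord_sub [DecidableEq F] {P Q : W.Point} (hP : P ≠ 0) (hQ : Q ≠ 0)
    (h : P.xCoord ≠ Q.xCoord) :
    ((P + Q).xCoord + (P - Q).xCoord) * (P.xCoord - Q.xCoord) ^ 2 =
      2 * P.xCoord * Q.xCoord * (P.xCoord + Q.xCoord) + W.b₂ * P.xCoord * Q.xCoord +
        W.b₄ * (P.xCoord + Q.xCoord) + W.b₆ := by
  rcases P with _ | ⟨x₁, y₁, h₁⟩
  · exact absurd rfl hP
  rcases Q with _ | ⟨x₂, y₂, h₂⟩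
  · exact absurd rfl hQ
  simp only [xCoord_some] at h
  have e₁ := (W.equation_iff _ _).mp h₁.1
  have e₂ := (W.equation_iff _ _).mp h₂.1
  rw [sub_eq_add_neg, neg_some, add_of_X_ne h, add_of_X_ne h]
  simp only [xCoord_some, slope_of_X_ne h, addX, negY]
  have h' : x₁ - x₂ ≠ 0 := sub_ne_zero.mpr h
  field_simp
  simp only [b₂, b₄, b₆]
  linear_combination 2 * e₁ + 2 * e₂

lemma add_self_eq_zero_iff [DecidableEq F] {P : W.Point} (hP : P ≠ 0) :
    P + P = 0 ↔ W.twoDiv P.xCoord = 0 := by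
  rcases P with _ | ⟨x, y, h⟩
  · exact absurd rfl hP
  have e := (W.equation_iff _ _).mp h.1
  -- Completing the square: `y - negY x y = 2y + a₁x + a₃`.
  have key : W.twoDiv x = (y - W.negY x y) ^ 2 := by
    simp only [twoDiv, negY, b₂, b₄, b₆]
    linear_combination -4 * e
  rw [xCoord_some, key, sq_eq_zero_iff, sub_eq_zero]
  refine ⟨fun h0 ↦ ?_, fun hy ↦ add_self_of_Y_eq hy⟩
  by_contra hy
  rw [add_self_of_Y_ne hy] at h0
  exact some_ne_zero _ h0

lemma xCoord_add_self_sub [DecidableEq F] {P : W.Point} (hP : P ≠ 0) (hPP : P + P ≠ 0) :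
    ((P + P).xCoord - P.xCoord) * W.twoDiv P.xCoord = -W.threeDiv P.xCoord := by
  have h2 := (add_self_eq_zero_iff hP).not.mp hPP
  rcases P with _ | ⟨x, y, h⟩
  · exact absurd rfl hP
  have e := (W.equation_iff _ _).mp h.1
  have key : W.twoDiv x = (y - W.negY x y) ^ 2 := by
    simp only [twoDiv, negY, b₂, b₄, b₆]
    linear_combination -4 * e
  rw [xCoord_some, key, sq_eq_zero_iff, sub_eq_zero] at h2
  rw [add_self_of_Y_ne h2]
  simp only [xCoord_some, slope_of_Y_ne rfl h2, addX, key]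
  have h' : y - W.negY x y ≠ 0 := sub_ne_zero.mpr h2
  field_simp
  simp only [threeDiv, negY, b₂, b₄, b₆, b₈]
  linear_combination (-(12 * x + 4 * W.a₂ + W.a₁ ^ 2)) * e

end Affine.Point

end WeierstrassCurve

/-! ### Multiples of a point in the kernel of reduction -/

namespace ValuationSubring

open IsLocalRing

variable {F : Type*} [Field F] (O : ValuationSubring F)

@[simp, norm_cast]
lemma coe_ofNat (n : ℕ) [n.AtLeastTwo] :
    ((ofNat(n) : O) : F) = (ofNat(n) : F) := rfl

/-- If `X n` are the `x`-coordinates of the multiples `n • P` of a point `P` in the kernel of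
reduction, then `n ^ 2 * X n / X 1` is congruent to `1` as long as `n` is small. -/
lemma exists_residue_mul_sq_eq_one {b₂ b₄ b₆ b₈ ε : O} {p : ℕ} (m : ℕ)
    [CharP (ResidueField O) p] {X : ℕ → F} (hε : residue O ε = 0) (hε1 : X 1 * ε = 1)
    (hD : X 2 * (4 * X 1 ^ 3 + b₂ * X 1 ^ 2 + 2 * b₄ * X 1 + b₆) =
      X 1 ^ 4 - b₄ * X 1 ^ 2 - 2 * b₆ * X 1 - b₈)
    (hS : ∀ n, 2 ≤ n → n + 1 < m → (X (n + 1) + X (n - 1)) * (X n - X 1) ^ 2 =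
      2 * X n * X 1 * (X n + X 1) + b₂ * X n * X 1 + b₄ * (X n + X 1) + b₆) :
    ∀ n : ℕ, 1 ≤ n → n < p → n < m →
      ∃ a : O, (a : F) = X n * ε ∧ residue O a * (n : ResidueField O) ^ 2 = 1 := by
  have hne : ∀ j : ℕ, 0 < j → j < p → (j : ResidueField O) ≠ 0 := fun j h0 hj h ↦
    Nat.not_dvd_of_pos_of_lt h0 hj ((CharP.cast_eq_zero_iff _ p j).mp h)
  intro n
  induction n using Nat.strong_induction_on with
  | _ n ih =>
    intro h1 hnp hnm
    obtain rfl | rfl | h3 : n = 1 ∨ n = 2 ∨ 3 ≤ n := by omega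
    · exact ⟨1, by simp [hε1], by simp⟩
    -- The denominator of the duplication formula after substituting `X 1 = ε⁻¹` and clearing powers
    -- of `ε`; it reduces to 4.
    · set d : O := 4 + b₂ * ε + 2 * b₄ * ε ^ 2 + b₆ * ε ^ 3 with hd
      have hd' : residue O d = (2 : ℕ) ^ 2 := by
        simp only [hd, map_add, map_mul, hε, map_pow, map_ofNat]
        push_cast
        ring
      have hdu : IsUnit d := by
        rw [← residue_ne_zero_iff_isUnit, hd']
        exact pow_ne_zero _ (hne 2 (by omega) hnp)
      obtain ⟨e, he⟩ := hdu.exists_right_inv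
      have heF : (d : F) * e = 1 := by exact_mod_cast congrArg (Subtype.val) he
      refine ⟨(1 - b₄ * ε ^ 2 - 2 * b₆ * ε ^ 3 - b₈ * ε ^ 4) * e, ?_, ?_⟩
      · have hdF : (d : F) = 4 + b₂ * ε + 2 * b₄ * ε ^ 2 + b₆ * ε ^ 3 := by
          rw [hd]; push_cast; rfl
        have hX : X 2 * ε * d = 1 - b₄ * ε ^ 2 - 2 * b₆ * ε ^ 3 - b₈ * ε ^ 4 := by
          have hε0 : (ε : F) ≠ 0 := right_ne_zero_of_mul_eq_one hε1
          have hX1 : X 1 = (ε : F)⁻¹ := eq_inv_of_mul_eq_one_left hε1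
          rw [hX1] at hD
          field_simp at hD
          rw [hdF]
          linear_combination hD
        push_cast
        rw [← hX, mul_assoc, heF, mul_one]
      · have := congrArg (residue O) he
        rw [map_mul, hd', map_one] at this
        simp only [map_sub, map_mul, map_one, map_pow, hε]
        linear_combination this
    · obtain ⟨k, rfl⟩ : ∃ k, n = k + 3 := ⟨n - 3, by omega⟩
      obtain ⟨a, ha, ha'⟩ := ih (k + 2) (by omega) (by omega) (by omega) (by omega)
      obtain ⟨a₀, ha₀, ha₀'⟩ := ih (k + 1) (by omega) (by omega) (by omega) (by omega)
      have hS := hS (k + 2) (by omega) (by omega)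
      rw [show k + 2 + 1 = k + 3 by rfl, show k + 2 - 1 = k + 1 by rfl] at hS
      have n1 := hne (k + 1) (by omega) (by omega)
      have n2 := hne (k + 2) (by omega) (by omega)
      have n3 := hne (k + 3) (by omega) (by omega)
      push_cast at ha' ha₀' n1 n2 n3 ⊢
      set t : ResidueField O := (k : ResidueField O)
      have hr : residue O a = 1 / (t + 2) ^ 2 := eq_one_div_of_mul_eq_one_left ha'
      have hr₀ : residue O a₀ = 1 / (t + 1) ^ 2 := eq_one_div_of_mul_eq_one_left ha₀'
      -- With `n = k + 3`, the recurrence divides by `(a - 1)²`; this factorization shows `a - 1` is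
      -- a unit because `n - 2`, `n - 1` and `n` are all nonzero modulo `p`.
      have hr1 : residue O (a - 1) = -(t + 1) * (t + 3) / (t + 2) ^ 2 := by
        rw [map_sub, hr, map_one]
        field_simp
        ring
      have hdu : IsUnit (a - 1) := by
        rw [← residue_ne_zero_iff_isUnit, hr1]
        exact div_ne_zero (mul_ne_zero (neg_ne_zero.mpr n1) n3) (pow_ne_zero _ n2)
      obtain ⟨e, he⟩ := hdu.exists_right_inv
      have heF : ((a : F) - 1) * e = 1 := by exact_mod_cast congrArg (Subtype.val) he
      refine ⟨(2 * a * (a + 1) + b₂ * ε * a + b₄ * ε ^ 2 * (a + 1) + b₆ * ε ^ 3) * e ^ 2 - a₀,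
        ?_, ?_⟩
      · have hε0 : (ε : F) ≠ 0 := right_ne_zero_of_mul_eq_one hε1
        have hX1 : X 1 = (ε : F)⁻¹ := eq_inv_of_mul_eq_one_left hε1
        have hXa : X (k + 2) = a * (ε : F)⁻¹ := by rw [ha]; field_simp
        have hXa₀ : X (k + 1) = a₀ * (ε : F)⁻¹ := by rw [ha₀]; field_simp
        rw [hX1, hXa, hXa₀] at hS
        field_simp at hS
        push_cast
        linear_combination (-(e : F) ^ 2) * hS +
          ((X (k + 3) * ε + a₀) * ((((a : F) - 1) * e) + 1)) * heF
      · have he' := congrArg (residue O) he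
        rw [map_mul, hr1, map_one] at he'
        have hre : residue O e = -(t + 2) ^ 2 / ((t + 1) * (t + 3)) := by
          field_simp at he' ⊢
          linear_combination -he'
        simp only [map_sub, map_mul, map_add, map_one, map_pow, map_ofNat, hε, hr, hr₀, hre]
        field_simp
        ring

/-- A substitute for the formal group: for `n < p`, `x(nP)` is `x(P)/n²` to leading order, while
multiplication by `p` gives a strictly larger pole. The latter contradicts a choice of `P` with
maximal `|x|`. -/
lemma exists_valuation_lt {b₂ b₄ b₆ b₈ : O} {p ℓ : ℕ} (hp : p.Prime) (hℓ : 3 ≤ ℓ) (hℓp : ℓ ≠ p)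
    [CharP (ResidueField O) p] {X : ℕ → F}
    (hD : X 2 * (4 * X 1 ^ 3 + b₂ * X 1 ^ 2 + 2 * b₄ * X 1 + b₆) =
      X 1 ^ 4 - b₄ * X 1 ^ 2 - 2 * b₆ * X 1 - b₈)
    (hS : ∀ n, 2 ≤ n → n + 1 < ℓ → (X (n + 1) + X (n - 1)) * (X n - X 1) ^ 2 =
      2 * X n * X 1 * (X n + X 1) + b₂ * X n * X 1 + b₄ * (X n + X 1) + b₆)
    (hlast : X (ℓ - 1) = X 1) (h1 : X 1 ∉ O) :
    ∃ n, 0 < n ∧ n < ℓ ∧ O.valuation (X 1) < O.valuation (X n) := by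
  have hX1 : X 1 ≠ 0 := fun h ↦ h1 (h ▸ O.zero_mem)
  obtain ⟨ε, hε⟩ : ∃ ε : O, (ε : F) = (X 1)⁻¹ :=
    ⟨⟨_, (O.mem_or_inv_mem (X 1)).resolve_left h1⟩, rfl⟩
  have hε1 : X 1 * ε = 1 := by rw [hε, mul_inv_cancel₀ hX1]
  have hεr : residue O ε = 0 := by
    by_contra h
    obtain ⟨e, he⟩ := ((residue_ne_zero_iff_isUnit ε).mp h).exists_right_inv
    have heF : (ε : F) * e = 1 := by exact_mod_cast congrArg (Subtype.val) he
    apply h1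
    rw [show X 1 = e by rw [← mul_one (X 1), ← heF, ← mul_assoc, hε1, one_mul]]
    exact e.2
  have claim := O.exists_residue_mul_sq_eq_one ℓ hεr hε1 hD hS
  have hne : ∀ j : ℕ, 0 < j → j < p → (j : ResidueField O) ≠ 0 := fun j h0 hj h ↦
    Nat.not_dvd_of_pos_of_lt h0 hj ((CharP.cast_eq_zero_iff _ p j).mp h)
  have hp2 := hp.two_le
  have hp0 : (p : ResidueField O) = 0 := CharP.cast_eq_zero _ p
  rcases lt_or_gt_of_ne hℓp with hlt | hlt
  -- If `ℓ < p`, then `X (ℓ - 1) = X 1` forces `(ℓ - 1)² = 1`, that is `ℓ(ℓ - 2) = 0` in the residue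
  -- field, which is impossible.
  · obtain ⟨a, ha, ha'⟩ := claim (ℓ - 1) (by omega) (by omega) (by omega)
    have ha1 : a = 1 := Subtype.ext (by rw [ha, hlast, hε1]; rfl)
    obtain ⟨k, rfl⟩ : ∃ k, ℓ = k + 3 := ⟨ℓ - 3, by omega⟩
    rw [ha1, map_one, one_mul, show k + 3 - 1 = k + 2 by rfl] at ha'
    have n1 := hne (k + 1) (by omega) (by omega)
    have n3 := hne (k + 3) (by omega) (by omega)
    push_cast at ha' n1 n3
    exact absurd (by linear_combination ha') (mul_ne_zero n1 n3)
  · refine ⟨p, hp.pos, hlt, ?_⟩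
    -- If `X p * ε` were integral, reducing the formula for `X p` would kill its left side: the
    -- result is `0 = 1` when `p = 2`, and `0 = 4` when `p` is odd, since then `a ≡ 1/(p - 1)² = 1`.
    suffices h : X p * ε ∉ O by
      rw [← valuation_le_one_iff, not_le, hε, map_mul, map_inv₀] at h
      have hv : 0 < O.valuation (X 1) := zero_lt_iff.mpr (by simpa using hX1)
      simpa using (lt_mul_inv_iff₀ hv).mp h
    intro hmem
    obtain ⟨c, hc⟩ : ∃ c : O, (c : F) = X p * ε := ⟨⟨_, hmem⟩, rfl⟩
    have hε0 : (ε : F) ≠ 0 := right_ne_zero_of_mul_eq_one hε1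
    have hX1' : X 1 = (ε : F)⁻¹ := eq_inv_of_mul_eq_one_left hε1
    have hXc : X p = c * (ε : F)⁻¹ := by rw [hc]; field_simp
    rcases hp2.eq_or_lt with rfl | hp3
    · rw [hX1', hXc] at hD
      field_simp at hD
      have hO : c * (4 + b₂ * ε + 2 * b₄ * ε ^ 2 + b₆ * ε ^ 3) =
          1 - b₄ * ε ^ 2 - 2 * b₆ * ε ^ 3 - b₈ * ε ^ 4 := by
        apply Subtype.ext
        push_cast
        linear_combination hD
      have := congrArg (residue O) hO
      simp only [map_sub, map_mul, map_add, map_one, map_pow, map_ofNat, hεr] at this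
      push_cast at hp0
      have h01 : (1 : ResidueField O) = 0 := by linear_combination -this + 2 * residue O c * hp0
      exact one_ne_zero h01
    · obtain ⟨k, rfl⟩ : ∃ k, p = k + 3 := ⟨p - 3, by omega⟩
      obtain ⟨a, ha, ha'⟩ := claim (k + 2) (by omega) (by omega) (by omega)
      obtain ⟨a₀, ha₀, -⟩ := claim (k + 1) (by omega) (by omega) (by omega)
      have hS := hS (k + 2) (by omega) (by omega)
      rw [show k + 2 + 1 = k + 3 by rfl, show k + 2 - 1 = k + 1 by rfl] at hS
      have hXa : X (k + 2) = a * (ε : F)⁻¹ := by rw [ha]; field_simp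
      have hXa₀ : X (k + 1) = a₀ * (ε : F)⁻¹ := by rw [ha₀]; field_simp
      rw [hX1', hXc, hXa, hXa₀] at hS
      field_simp at hS
      have hO : (c + a₀) * (a - 1) ^ 2 =
          2 * a * (a + 1) + b₂ * ε * a + b₄ * ε ^ 2 * (a + 1) + b₆ * ε ^ 3 := by
        apply Subtype.ext
        push_cast
        linear_combination hS
      have hO := congrArg (residue O) hO
      simp only [map_sub, map_mul, map_add, map_one, map_pow, map_ofNat, hεr] at hO
      push_cast at ha' hp0
      have hra : residue O a = 1 := by
        have : ((k : ResidueField O) + 2) = -1 := by linear_combination hp0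
        rw [this] at ha'
        linear_combination ha'
      rw [hra] at hO
      have h2 := hne 2 (by omega) (by omega)
      push_cast at h2
      exact absurd (by linear_combination -hO) (mul_ne_zero h2 h2)

end ValuationSubring

/-! ### Points of order `ℓ` on a model with good reduction -/

namespace WeierstrassCurve

open IsLocalRing

section VariableChange

variable {F : Type*} [Field F] (W : WeierstrassCurve F) (C : VariableChange F)

/-- The `x`-coordinate of a point after a change of variables. -/
def VariableChange.xMap (x : F) : F := (C.u⁻¹ : Fˣ) ^ 2 * (x - C.r)

lemma twoDiv_variableChange (x : F) :
    (C • W).twoDiv (C.xMap x) = (C.u⁻¹ : Fˣ) ^ 6 * W.twoDiv x := by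
  simp only [twoDiv, VariableChange.xMap, variableChange_b₂, variableChange_b₄, variableChange_b₆]
  ring

lemma threeDiv_variableChange (x : F) :
    (C • W).threeDiv (C.xMap x) = (C.u⁻¹ : Fˣ) ^ 8 * W.threeDiv x := by
  simp only [threeDiv, VariableChange.xMap, variableChange_b₂, variableChange_b₄,
    variableChange_b₆, variableChange_b₈]
  ring

end VariableChange

namespace Affine.Point

variable {F : Type*} [Field F] [DecidableEq F] {W : WeierstrassCurve F} {ℓ : ℕ}

lemma nsmul_ne_zero_of_lt (hℓ : ℓ.Prime) {P : W.toAffine.Point} (hP : P ≠ 0) (hℓP : ℓ • P = 0)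
    {n : ℕ} (h0 : 0 < n) (hn : n < ℓ) : n • P ≠ 0 := by
  have := Fact.mk hℓ
  have ho : addOrderOf P = ℓ := addOrderOf_eq_prime_iff.mpr ⟨hℓP, hP⟩
  intro h
  exact Nat.not_dvd_of_pos_of_lt h0 hn (ho ▸ addOrderOf_dvd_of_nsmul_eq_zero h)

/-- Equality would give `nP = ±P`, hence `(n - 1)P = 0` or `(n + 1)P = 0`, and both indices lie
strictly between 0 and `ℓ`. -/
lemma xCoord_nsmul_ne (hℓ : ℓ.Prime) {P : W.toAffine.Point} (hP : P ≠ 0) (hℓP : ℓ • P = 0)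
    {n : ℕ} (h2 : 2 ≤ n) (hn : n + 1 < ℓ) : (n • P).xCoord ≠ P.xCoord := by
  intro h
  rcases eq_or_eq_neg_of_xCoord_eq (nsmul_ne_zero_of_lt hℓ hP hℓP (by omega) (by omega)) hP h
    with h | h
  · refine nsmul_ne_zero_of_lt hℓ hP hℓP (n := n - 1) (by omega) (by omega) ?_
    obtain ⟨k, rfl⟩ : ∃ k, n = k + 1 := ⟨n - 1, by omega⟩
    rw [succ_nsmul] at h
    simpa using h
  · refine nsmul_ne_zero_of_lt hℓ hP hℓP (n := n + 1) (by omega) (by omega) ?_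
    rw [succ_nsmul, h, neg_add_cancel]

variable (C : VariableChange F)

lemma xMap_nsmul_recurrence (hℓ : ℓ.Prime) {P : W.toAffine.Point} (hP : P ≠ 0)
    (hℓP : ℓ • P = 0) {n : ℕ} (h2 : 2 ≤ n) (hn : n + 1 < ℓ) :
    (C.xMap ((n + 1) • P).xCoord + C.xMap ((n - 1) • P).xCoord) *
        (C.xMap (n • P).xCoord - C.xMap (1 • P).xCoord) ^ 2 =
      2 * C.xMap (n • P).xCoord * C.xMap (1 • P).xCoord *
          (C.xMap (n • P).xCoord + C.xMap (1 • P).xCoord) +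
        (C • W).b₂ * C.xMap (n • P).xCoord * C.xMap (1 • P).xCoord +
        (C • W).b₄ * (C.xMap (n • P).xCoord + C.xMap (1 • P).xCoord) + (C • W).b₆ := by
  have h := xCoord_add_add_xCoord_sub
    (nsmul_ne_zero_of_lt hℓ hP hℓP (by omega) (by omega)) hP (xCoord_nsmul_ne hℓ hP hℓP h2 hn)
  obtain ⟨k, rfl⟩ : ∃ k, n = k + 1 := ⟨n - 1, by omega⟩
  rw [← succ_nsmul, succ_nsmul P k, add_sub_cancel_right, ← succ_nsmul P k] at h
  rw [Nat.add_sub_cancel, one_nsmul]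
  simp only [VariableChange.xMap, variableChange_b₂, variableChange_b₄, variableChange_b₆]
  linear_combination (C.u⁻¹ : Fˣ) ^ 6 * h

lemma xMap_two_nsmul (hℓ : ℓ.Prime) (hℓ2 : 2 < ℓ) {P : W.toAffine.Point} (hP : P ≠ 0)
    (hℓP : ℓ • P = 0) :
    (C.xMap (2 • P).xCoord - C.xMap (1 • P).xCoord) * (C • W).twoDiv (C.xMap (1 • P).xCoord) =
      -(C • W).threeDiv (C.xMap (1 • P).xCoord) := by
  have h := xCoord_add_self_sub hP
    (by rw [← two_nsmul]; exact nsmul_ne_zero_of_lt hℓ hP hℓP (by omega) (by omega))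
  rw [← two_nsmul] at h
  rw [twoDiv_variableChange, threeDiv_variableChange, one_nsmul]
  simp only [VariableChange.xMap]
  linear_combination (C.u⁻¹ : Fˣ) ^ 8 * h

variable (O : ValuationSubring F) {p : ℕ} [CharP (ResidueField O) p] {C}

lemma exists_valuation_xMap_lt (hp : p.Prime) (hℓ : ℓ.Prime) (hℓ2 : 2 < ℓ) (hℓp : ℓ ≠ p)
    (hC : IsIntegral O (C • W)) {P : W.toAffine.Point} (hP : P ≠ 0) (hℓP : ℓ • P = 0)
    (hPO : C.xMap P.xCoord ∉ O) :
    ∃ n, 0 < n ∧ n < ℓ ∧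
      O.valuation (C.xMap P.xCoord) < O.valuation (C.xMap (n • P).xCoord) := by
  obtain ⟨V, hV⟩ := hC.integral
  have hb₂ : (C • W).b₂ = V.b₂ := by rw [hV]; exact V.map_b₂ _
  have hb₄ : (C • W).b₄ = V.b₄ := by rw [hV]; exact V.map_b₄ _
  have hb₆ : (C • W).b₆ = V.b₆ := by rw [hV]; exact V.map_b₆ _
  have hb₈ : (C • W).b₈ = V.b₈ := by rw [hV]; exact V.map_b₈ _
  have := O.exists_valuation_lt (b₂ := V.b₂) (b₄ := V.b₄) (b₆ := V.b₆) (b₈ := V.b₈) hp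
    hℓ2 hℓp (X := fun n ↦ C.xMap (n • P).xCoord) ?_ ?_ ?_ ?_
  · simpa using this
  · have := xMap_two_nsmul C hℓ hℓ2 hP hℓP
    simp only [twoDiv, threeDiv, hb₂, hb₄, hb₆, hb₈] at this
    linear_combination this
  · intro n h2 hn
    simpa only [hb₂, hb₄, hb₆] using xMap_nsmul_recurrence C hℓ hP hℓP h2 hn
  · have : (ℓ - 1) • P = -P := by
      rw [eq_neg_iff_add_eq_zero, ← succ_nsmul, Nat.sub_add_cancel hℓ.one_le, hℓP]
    simp only [this, xCoord_neg, one_nsmul]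
  · simpa using hPO

/-- Take the nonzero multiple of `P` whose `x`-coordinate has the largest valuation. Were it not
integral, `exists_valuation_xMap_lt` would give one of its multiples, again a nonzero multiple of
`P`, with a larger valuation. -/
lemma xMap_nsmul_mem (hp : p.Prime) (hℓ : ℓ.Prime) (hℓ2 : 2 < ℓ) (hℓp : ℓ ≠ p)
    (hC : IsIntegral O (C • W)) {P : W.toAffine.Point} (hP : P ≠ 0) (hℓP : ℓ • P = 0)
    {n : ℕ} (h0 : 0 < n) (hn : n < ℓ) : C.xMap (n • P).xCoord ∈ O := by
  obtain ⟨m, hm, hmax⟩ := (Finset.Ico 1 ℓ).exists_max_image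
    (fun n ↦ O.valuation (C.xMap (n • P).xCoord)) ⟨1, by simp; omega⟩
  rw [Finset.mem_Ico] at hm
  by_contra hnO
  have hmO : C.xMap (m • P).xCoord ∉ O := by
    rw [← O.valuation_le_one_iff, not_le] at hnO ⊢
    exact hnO.trans_le (hmax n (by simp; omega))
  obtain ⟨k, hk0, hk, hlt⟩ := exists_valuation_xMap_lt O hp hℓ hℓ2 hℓp hC
    (nsmul_ne_zero_of_lt hℓ hP hℓP (by omega) hm.2)
    (by rw [← mul_nsmul', mul_nsmul, hℓP, nsmul_zero]) hmO
  refine hlt.not_ge ?_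
  have hmod : k • m • P = (k * m % ℓ) • P := by
    rw [← mul_nsmul', ← Nat.mod_add_div (k * m) ℓ, add_nsmul, mul_nsmul, hℓP]
    simp
  rw [hmod]
  refine hmax _ (Finset.mem_Ico.mpr ⟨Nat.pos_of_ne_zero fun h ↦ ?_, Nat.mod_lt _ hℓ.pos⟩)
  rcases hℓ.dvd_mul.mp (Nat.dvd_of_mod_eq_zero h) with h | h
  · exact Nat.not_dvd_of_pos_of_lt hk0 hk h
  · exact Nat.not_dvd_of_pos_of_lt hm.1 hm.2 h

/-- For a point `P` of prime order `ℓ > 3` prime to the residue characteristic on a curve that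
acquires good reduction after the change of variables `C`, the sixth power of
`x(2P) - x(P)` is the discriminant up to a unit. -/
theorem valuation_threeDiv_div_twoDiv (hp : p.Prime) (hℓ : ℓ.Prime) (hℓ3 : 3 < ℓ) (hℓp : ℓ ≠ p)
    (hC : IsIntegral O (C • W)) (hΔ : O.valuation (C • W).Δ = 1) {P : W.toAffine.Point}
    (hP : P ≠ 0) (hℓP : ℓ • P = 0) :
    O.valuation ((W.threeDiv P.xCoord / W.twoDiv P.xCoord) ^ 6) = O.valuation W.Δ := by
  have hX := fun n h0 hn ↦ xMap_nsmul_mem O hp hℓ (by omega) hℓp hC hP hℓP (n := n) h0 hn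
  obtain ⟨X₁, hX₁⟩ : ∃ x : O, (x : F) = C.xMap (1 • P).xCoord :=
    ⟨⟨_, hX 1 (by omega) (by omega)⟩, rfl⟩
  obtain ⟨X₂, hX₂⟩ : ∃ x : O, (x : F) = C.xMap (2 • P).xCoord :=
    ⟨⟨_, hX 2 (by omega) (by omega)⟩, rfl⟩
  -- Here `ℓ > 3` is essential: `3P` must be a nonzero point.
  obtain ⟨X₃, hX₃⟩ : ∃ x : O, (x : F) = C.xMap (3 • P).xCoord :=
    ⟨⟨_, hX 3 (by omega) (by omega)⟩, rfl⟩
  obtain ⟨V, hV⟩ := hC.integral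
  have hb₂ : (C • W).b₂ = V.b₂ := by rw [hV]; exact V.map_b₂ _
  have hb₄ : (C • W).b₄ = V.b₄ := by rw [hV]; exact V.map_b₄ _
  have hb₆ : (C • W).b₆ = V.b₆ := by rw [hV]; exact V.map_b₆ _
  have hVΔ : (C • W).Δ = V.Δ := by rw [hV]; exact V.map_Δ _
  have htwo : (C • W).twoDiv X₁ = V.twoDiv X₁ := by rw [hV]; exact V.twoDiv_map _ X₁
  have hthree : (C • W).threeDiv X₁ = V.threeDiv X₁ := by rw [hV]; exact V.threeDiv_map _ X₁
  have hdbl := xMap_two_nsmul C hℓ (by omega) hP hℓP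
  rw [← hX₁, ← hX₂, htwo, hthree] at hdbl
  have hdblO : (X₂ - X₁) * V.twoDiv X₁ = -V.threeDiv X₁ := by
    exact_mod_cast hdbl
  have htri := xMap_nsmul_recurrence C hℓ hP hℓP le_rfl (by omega)
  rw [show 2 + 1 = 3 by rfl, show 2 - 1 = 1 by rfl, ← hX₁, ← hX₂, ← hX₃, hb₂, hb₄, hb₆] at htri
  have htriO : (X₃ + X₁) * (X₂ - X₁) ^ 2 = 2 * X₂ * X₁ * (X₂ + X₁) + V.b₂ * X₂ * X₁ +
      V.b₄ * (X₂ + X₁) + V.b₆ := by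
    exact_mod_cast htri
  have hΔu : IsUnit V.Δ := by
    rw [hVΔ] at hΔ
    exact (O.valuation_eq_one_iff _).mpr hΔ
  -- A chain of divisibilities in `O`: `X₂ - X₁` divides `twoDiv X₁` by the formula for `3P`, and
  -- `twoDiv X₁` divides the unit `Δ`.
  have htwou : IsUnit (V.twoDiv X₁) := by
    refine isUnit_of_dvd_unit ?_ hΔu
    rw [V.Δ_eq_twoDiv_threeDiv X₁, ← neg_eq_iff_eq_neg.mpr hdblO]
    exact dvd_add (dvd_mul_right _ _) (Dvd.dvd.mul_right ((dvd_mul_left _ _).neg_right) _)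
  have hdu : IsUnit (X₂ - X₁) := by
    refine isUnit_of_dvd_unit ?_ htwou
    have : V.twoDiv X₁ = (X₂ - X₁) * ((X₃ + X₁) * (X₂ - X₁) -
        (2 * X₁ * (X₂ + 2 * X₁) + V.b₂ * X₁ + V.b₄)) := by
      simp only [twoDiv]
      linear_combination -htriO
    exact ⟨_, this⟩
  have hdiv : W.threeDiv P.xCoord / W.twoDiv P.xCoord = -((C.u : F) ^ 2 * (X₂ - X₁ : O)) := by
    have h2 := W.twoDiv_variableChange C P.xCoord
    have h3 := W.threeDiv_variableChange C P.xCoord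
    rw [one_nsmul] at hX₁
    rw [← hX₁, htwo] at h2
    rw [← hX₁, hthree] at h3
    have hd : (X₂ - X₁ : O) * (V.twoDiv X₁ : F) = -V.threeDiv X₁ := by exact_mod_cast hdblO
    have htwo0 : (V.twoDiv X₁ : F) ≠ 0 := fun h ↦ htwou.ne_zero (Subtype.ext h)
    rw [h2] at hd htwo0
    rw [h3] at hd
    rw [div_eq_iff (right_ne_zero_of_mul htwo0)]
    have hu : (C.u : F) * (C.u⁻¹ : Fˣ) = 1 := C.u.mul_inv
    have hu' : ((C.u⁻¹ : Fˣ) : F) = (C.u : F)⁻¹ := Units.val_inv_eq_inv_val _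
    rw [hu'] at hd
    have hu0 : (C.u : F) ≠ 0 := C.u.ne_zero
    field_simp at hd
    linear_combination hd
  have hΔW : (C.u : F) ^ 12 * (C • W).Δ = W.Δ := by
    rw [variableChange_Δ, ← mul_assoc, ← mul_pow, C.u.mul_inv, one_pow, one_mul]
  have hd1 : O.valuation (X₂ - X₁ : O) = 1 := (O.valuation_eq_one_iff _).mp hdu
  rw [hdiv, ← hΔW, map_pow, Valuation.map_neg, map_mul, hd1, map_mul, hΔ, mul_one, mul_one,
    map_pow, map_pow, ← pow_mul]

end Affine.Point

end WeierstrassCurve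

/-! ### The function field over `K(x)` and the degree of a morphism -/

namespace WeierstrassCurve

open scoped RatFunc

variable {K : Type*} [Field K]

section FunctionField

variable (E : WeierstrassCurve K)

/-- The embedding of the field of rational functions in `x` in the function field. -/
def ratFuncMap : RatFunc K →ₐ[K] E.toAffine.FunctionField :=
  IsScalarTower.toAlgHom K (RatFunc K) E.toAffine.FunctionField

lemma ratFuncMap_algebraMap (q : K[X]) :
    E.ratFuncMap (algebraMap K[X] (RatFunc K) q) =
      algebraMap E.toAffine.CoordinateRing E.toAffine.FunctionField
        (Affine.CoordinateRing.mk E.toAffine (C q)) :=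
  (IsScalarTower.algebraMap_apply K[X] (RatFunc K) E.toAffine.FunctionField q).symm

lemma ratFuncMap_X : E.ratFuncMap RatFunc.X = E.xFun := by
  rw [← RatFunc.algebraMap_X, ratFuncMap_algebraMap, xFun]

lemma finrank_coordinateRing : Module.finrank K[X] E.toAffine.CoordinateRing = 2 := by
  rw [Module.finrank_eq_card_basis (Affine.CoordinateRing.basis E.toAffine), Fintype.card_fin]

instance : Module.Finite K[X] E.toAffine.CoordinateRing :=
  .of_basis (Affine.CoordinateRing.basis E.toAffine)

lemma finrank_functionField : Module.finrank (RatFunc K) E.toAffine.FunctionField = 2 := by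
  rw [← E.finrank_coordinateRing]
  exact IsFractionRing.finrank_eq K[X] (RatFunc K) E.toAffine.CoordinateRing _

lemma map_top_ratFuncMap : (⊤ : IntermediateField K (RatFunc K)).map E.ratFuncMap =
    IntermediateField.adjoin K {E.xFun} := by
  rw [← RatFunc.adjoin_X, IntermediateField.adjoin_map, Set.image_singleton, ratFuncMap_X]

lemma finrank_adjoin_xFun :
    Module.finrank (IntermediateField.adjoin K {E.xFun}) E.toAffine.FunctionField = 2 := by
  rw [← E.map_top_ratFuncMap, ← E.finrank_functionField, ← AlgHom.fieldRange_eq_map]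
  exact (Algebra.finrank_eq_of_equiv_equiv
    (AlgEquiv.ofInjectiveField E.ratFuncMap).toRingEquiv (RingEquiv.refl _) rfl).symm

/-- Every element of the function field has a denominator in `K[x]`. -/
lemma exists_mul_eq_mk (g : E.toAffine.FunctionField) : ∃ a₀ a₁ d : K[X], d ≠ 0 ∧
    g * algebraMap E.toAffine.CoordinateRing E.toAffine.FunctionField
        (Affine.CoordinateRing.mk E.toAffine (C d)) =
      algebraMap E.toAffine.CoordinateRing E.toAffine.FunctionField
        (Affine.CoordinateRing.mk E.toAffine (C a₀ + C a₁ * Y)) := by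
  obtain ⟨n, m, hm, rfl⟩ := IsFractionRing.div_surjective (A := E.toAffine.CoordinateRing) g
  obtain ⟨d, hd, k, hk⟩ := (Algebra.IsAlgebraic.isAlgebraic (R := K[X]) m).exists_nonzero_dvd hm
  obtain ⟨a₀, a₁, ha⟩ := Affine.CoordinateRing.exists_smul_basis_eq (n * k)
  refine ⟨a₀, a₁, d, hd, ?_⟩
  have hm0 : algebraMap E.toAffine.CoordinateRing E.toAffine.FunctionField m ≠ 0 :=
    IsFractionRing.to_map_ne_zero_of_mem_nonZeroDivisors hm
  rw [show Affine.CoordinateRing.mk E.toAffine (C d) = m * k from hk, map_mul]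
  rw [Affine.CoordinateRing.smul, Affine.CoordinateRing.smul, mul_one, ← map_mul, ← map_add] at ha
  rw [ha, map_mul]
  field_simp

lemma xFun_ne_zero : E.xFun ≠ 0 := by
  rw [← ratFuncMap_X]
  exact (_root_.map_ne_zero _).mpr RatFunc.X_ne_zero

end FunctionField

/-- The degree of a morphism whose effect on the `x`-coordinate is a rational function of `x`. -/
lemma extensionDegree_eq_max_natDegree {E E' : WeierstrassCurve K}
    (f : E'.toAffine.FunctionField →ₐ[K] E.toAffine.FunctionField) {r : RatFunc K}
    (hr : f E'.xFun = E.ratFuncMap r) :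
    extensionDegree f = max r.num.natDegree r.denom.natDegree := by
  have h1 : (IntermediateField.adjoin K {E'.xFun}).map f =
      (IntermediateField.adjoin K {r}).map E.ratFuncMap := by
    simp only [IntermediateField.adjoin_map, Set.image_singleton, hr]
  -- The degree of `K(E)` over the field generated by `f(x')` is computed through `f(K(E'))` and
  -- through `K(x)`; the factor 2 cancels.
  have h2 := IntermediateField.relfinrank_mul_finrank_top
    (IntermediateField.map_mono f (le_top (a := IntermediateField.adjoin K {E'.xFun})))
  have h3 := IntermediateField.relfinrank_mul_finrank_top
    (IntermediateField.map_mono E.ratFuncMap (le_top (a := IntermediateField.adjoin K {r})))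
  rw [IntermediateField.relfinrank_map_map, IntermediateField.relfinrank_top_right,
    finrank_adjoin_xFun, h1, ← AlgHom.fieldRange_eq_map] at h2
  rw [IntermediateField.relfinrank_map_map, IntermediateField.relfinrank_top_right,
    map_top_ratFuncMap, finrank_adjoin_xFun, RatFunc.finrank_eq_max_natDegree] at h3
  rw [extensionDegree]
  omega

end WeierstrassCurve

/-! ### Isogenies on `x`-coordinates -/

namespace WeierstrassCurve

open scoped RatFunc

section AlgClosed

variable {F : Type*} [Field F] (W : WeierstrassCurve F)

lemma exists_nonsingular [IsAlgClosed F] [W.IsElliptic] (x : F) :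
    ∃ y, W.toAffine.Nonsingular x y := by
  set q : F[X] := X ^ 2 + C (W.a₁ * x + W.a₃) * X +
    C (-(x ^ 3 + W.a₂ * x ^ 2 + W.a₄ * x + W.a₆)) with hq
  have hdeg : q.degree = 2 := by rw [hq]; compute_degree!
  obtain ⟨y, hy⟩ := IsAlgClosed.exists_root q (by rw [hdeg]; norm_num)
  refine ⟨y, Affine.equation_iff_nonsingular.mp ((Affine.equation_iff ..).mpr ?_)⟩
  simp [hq] at hy
  linear_combination hy

/-- Only characteristic 2 is at issue: vanishing coefficients give `4 = b₂ = b₆ = 0`, leaving `Δ =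
-8b₄³ = 0`. -/
lemma Ψ₂Sq_ne_zero_of_isElliptic [W.IsElliptic] : W.Ψ₂Sq ≠ 0 := by
  intro h
  have h0 := congrArg (coeff · 0) h
  have h1 := congrArg (coeff · 1) h
  have h2 := congrArg (coeff · 2) h
  have h3 := congrArg (coeff · 3) h
  simp [Ψ₂Sq, coeff_X, coeff_C] at h0 h1 h2 h3
  have h4 : (4 : F) = 0 := by simpa [coeff_ofNat_mul] using h3
  refine W.isUnit_Δ.ne_zero ?_
  rw [Δ, h2, h0]
  linear_combination (-2 * W.b₄ ^ 3) * h4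

lemma eval_Ψ₂Sq (x : F) : W.Ψ₂Sq.eval x = W.twoDiv x := by
  simp [Ψ₂Sq, twoDiv]

lemma eval_Ψ₃ (x : F) : W.Ψ₃.eval x = W.threeDiv x := by
  simp [Ψ₃, threeDiv]

end AlgClosed

section DivisionPolynomials

variable {K A : Type*} [Field K] [Field A] [Algebra K A] (E : WeierstrassCurve K)

lemma aeval_Ψ₂Sq (x : A) : aeval x E.Ψ₂Sq = (E.baseChange A).twoDiv x := by
  rw [← eval_Ψ₂Sq, baseChange, map_Ψ₂Sq, eval_map_algebraMap]

lemma aeval_Ψ₃ (x : A) : aeval x E.Ψ₃ = (E.baseChange A).threeDiv x := by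
  rw [← eval_Ψ₃, baseChange, map_Ψ₃, eval_map_algebraMap]

end DivisionPolynomials

variable {K : Type*} [Field K] {E E' : WeierstrassCurve K}

instance {A : Type*} [CommRing A] [Algebra K A] [E.IsElliptic] : (E.baseChange A).IsElliptic :=
  inferInstanceAs (E.map (algebraMap K A)).IsElliptic

lemma aevalAeval_eq_of_mk_eq {A : Type*} [CommRing A] [Algebra K A] {x y : A}
    (h : (E.baseChange A).toAffine.Equation x y) {a b : K[X][Y]}
    (hab : Affine.CoordinateRing.mk E.toAffine a = Affine.CoordinateRing.mk E.toAffine b) :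
    aevalAeval x y a = aevalAeval x y b := by
  obtain ⟨c, hc⟩ := AdjoinRoot.mk_eq_mk.mp hab
  have h0 : aevalAeval x y E.toAffine.polynomial = 0 := by
    rw [Affine.equation_iff'] at h
    simp only [Affine.polynomial, map_sub, map_add, map_mul, map_pow, aevalAeval_C,
      aevalAeval_Y, aeval_C, aeval_X]
    simp only [baseChange, map_a₁, map_a₂, map_a₃, map_a₄, map_a₆] at h
    linear_combination h
  rw [← sub_eq_zero, ← map_sub, hc, map_mul, h0, zero_mul]

lemma mk_algebraMap_injective : Function.Injective
    (algebraMap E.toAffine.CoordinateRing E.toAffine.FunctionField) :=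
  IsFractionRing.injective _ _

section SendsTo

variable {x y : AlgebraicClosure K} {a d : K[X][Y]}

/-- The value can be tested on any fraction representing `g`. The cross-multiplied form stays valid
where the denominator `d` vanishes. -/
lemma HasValueAt.aevalAeval_eq {g : E.toAffine.FunctionField} {c : AlgebraicClosure K}
    (hg : E.HasValueAt g x y c)
    (h : (E.baseChange (AlgebraicClosure K)).toAffine.Equation x y)
    (hgd : g * algebraMap E.toAffine.CoordinateRing E.toAffine.FunctionField
        (Affine.CoordinateRing.mk E.toAffine d) =
      algebraMap E.toAffine.CoordinateRing E.toAffine.FunctionField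
        (Affine.CoordinateRing.mk E.toAffine a)) :
    aevalAeval x y a = c * aevalAeval x y d := by
  obtain ⟨a', b', hb, hg', rfl⟩ := hg
  have : Affine.CoordinateRing.mk E.toAffine (a * b') =
      Affine.CoordinateRing.mk E.toAffine (a' * d) := by
    apply mk_algebraMap_injective
    simp only [map_mul]
    rw [← hgd, ← hg']
    ring
  have := aevalAeval_eq_of_mk_eq h this
  rw [map_mul, map_mul] at this
  field_simp
  exact this

lemma HasValueAt.aevalAeval_eq_zero_of_inv {g : E.toAffine.FunctionField} (hg0 : g ≠ 0)
    (hg : E.HasValueAt g⁻¹ x y 0)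
    (h : (E.baseChange (AlgebraicClosure K)).toAffine.Equation x y)
    (hgd : g * algebraMap E.toAffine.CoordinateRing E.toAffine.FunctionField
        (Affine.CoordinateRing.mk E.toAffine d) =
      algebraMap E.toAffine.CoordinateRing E.toAffine.FunctionField
        (Affine.CoordinateRing.mk E.toAffine a)) :
    aevalAeval x y d = 0 := by
  have := hg.aevalAeval_eq h (a := d) (d := a) (by rw [← hgd]; field_simp)
  rwa [zero_mul] at this

end SendsTo

namespace Isogeny

variable (φ : Isogeny E E')

lemma comap_xFun_ne_zero : φ.comap E'.xFun ≠ 0 :=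
  (_root_.map_ne_zero _).mpr E'.xFun_ne_zero

section

variable {a d : K[X][Y]}
    (hgd : φ.comap E'.xFun * algebraMap E.toAffine.CoordinateRing E.toAffine.FunctionField
        (Affine.CoordinateRing.mk E.toAffine d) =
      algebraMap E.toAffine.CoordinateRing E.toAffine.FunctionField
        (Affine.CoordinateRing.mk E.toAffine a))
include hgd

lemma aevalAeval_eq_zero {x y : AlgebraicClosure K}
    (h : (E.baseChange (AlgebraicClosure K)).toAffine.Nonsingular x y)
    (h0 : φ.toHom (.some x y h) = 0) : aevalAeval x y d = 0 := by
  have hs := φ.sendsTo x y h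
  rw [h0] at hs
  exact HasValueAt.aevalAeval_eq_zero_of_inv φ.comap_xFun_ne_zero hs h.1 hgd

lemma aevalAeval_eq {x y : AlgebraicClosure K}
    (h : (E.baseChange (AlgebraicClosure K)).toAffine.Nonsingular x y)
    (h0 : φ.toHom (.some x y h) ≠ 0) :
    aevalAeval x y a = (φ.toHom (.some x y h)).xCoord * aevalAeval x y d := by
  have hs := φ.sendsTo x y h
  match hQ : φ.toHom (.some x y h) with
  | .zero => exact absurd hQ h0
  | .some x' y' h' =>
    rw [hQ] at hs
    exact hs.1.aevalAeval_eq h.1 hgd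

end

open scoped Classical in
/-- The effect of an isogeny on the `x`-coordinate is a rational function of `x`. -/
lemma exists_comap_xFun_eq [E.IsElliptic] :
    ∃ r : RatFunc K, φ.comap E'.xFun = E.ratFuncMap r := by
  obtain ⟨a₀, a₁, d, hd, hgd⟩ := E.exists_mul_eq_mk (φ.comap E'.xFun)
  -- The product is shown to vanish at every geometric `x`. The factors `d` and `Ψ₂Sq` discard the
  -- possible poles and the 2-torsion.
  have hmul : a₁ * (d * E.Ψ₂Sq) = 0 := by
    have : (a₁ * (d * E.Ψ₂Sq)).map (algebraMap K (AlgebraicClosure K)) = 0 := by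
      apply Polynomial.funext
      intro x
      obtain ⟨y, h⟩ := (E.baseChange (AlgebraicClosure K)).exists_nonsingular x
      by_contra hne
      rw [eval_zero, eval_map_algebraMap, map_mul, map_mul] at hne
      have hd0 := left_ne_zero_of_mul (right_ne_zero_of_mul hne)
      have h20 := right_ne_zero_of_mul (right_ne_zero_of_mul hne)
      have ha0 := left_ne_zero_of_mul hne
      set P : (E.baseChange (AlgebraicClosure K)).toAffine.Point := .some x y h with hP
      have h' := (Affine.nonsingular_neg ..).mpr h
      have hnz : φ.toHom P ≠ 0 := fun h0 ↦ hd0 <| by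
        simpa using φ.aevalAeval_eq_zero hgd h h0
      have hnegP : φ.toHom (.some _ _ h') = -φ.toHom P := by
        rw [← map_neg, hP, Affine.Point.neg_some]
      have hnz' : φ.toHom (.some _ _ h') ≠ 0 := by
        rw [hnegP]; exact neg_ne_zero.mpr hnz
      have e := φ.aevalAeval_eq hgd h hnz
      have e' := φ.aevalAeval_eq hgd h' hnz'
      rw [hnegP, Affine.Point.xCoord_neg] at e'
      simp only [map_add, map_mul, aevalAeval_C, aevalAeval_Y] at e e'
      -- The images of `P` and `-P` are opposite, so `a₀ + a₁y` takes the same value at both points.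
      have hyy : aeval x a₁ * (y - (E.baseChange (AlgebraicClosure K)).toAffine.negY x y) = 0 := by
        linear_combination e - e'
      refine h20 ?_
      have hy := (mul_eq_zero.mp hyy).resolve_left ha0
      have heq := (Affine.equation_iff ..).mp h.1
      rw [E.aeval_Ψ₂Sq]
      simp only [twoDiv, b₂, b₄, b₆]
      rw [Affine.negY] at hy
      linear_combination -4 * heq + (2 * y + (E.baseChange (AlgebraicClosure K)).a₁ * x +
        (E.baseChange (AlgebraicClosure K)).a₃) * hy
    exact (Polynomial.map_eq_zero _).mp this
  have ha₁ : a₁ = 0 := (mul_eq_zero.mp hmul).resolve_right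
    (mul_ne_zero hd E.Ψ₂Sq_ne_zero_of_isElliptic)
  refine ⟨algebraMap _ _ a₀ / algebraMap _ _ d, ?_⟩
  have hd' : E.ratFuncMap (algebraMap K[X] (RatFunc K) d) ≠ 0 :=
    (_root_.map_ne_zero _).mpr (by simpa using hd)
  rw [ha₁, map_zero, zero_mul, add_zero, ← ratFuncMap_algebraMap, ← ratFuncMap_algebraMap] at hgd
  rw [map_div₀, eq_div_iff hd', hgd]

/-- The effect of an isogeny on the `x`-coordinates of geometric points. -/
lemma exists_isCoprime_xCoord [E.IsElliptic] : ∃ u w : K[X], IsCoprime u w ∧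
    φ.degree = max u.natDegree w.natDegree ∧
    ∀ P, P ≠ 0 → (φ.toHom P = 0 ↔ aeval P.xCoord w = 0) ∧
      (φ.toHom P ≠ 0 → aeval P.xCoord u = (φ.toHom P).xCoord * aeval P.xCoord w) := by
  obtain ⟨r, hr⟩ := φ.exists_comap_xFun_eq
  have hgd : φ.comap E'.xFun * algebraMap E.toAffine.CoordinateRing E.toAffine.FunctionField
        (Affine.CoordinateRing.mk E.toAffine (C r.denom)) =
      algebraMap E.toAffine.CoordinateRing E.toAffine.FunctionField
        (Affine.CoordinateRing.mk E.toAffine (C r.num)) := by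
    rw [hr, ← ratFuncMap_algebraMap, ← ratFuncMap_algebraMap, ← map_mul]
    congr 1
    nth_rw 1 [← r.num_div_denom]
    exact div_mul_cancel₀ _ (RatFunc.algebraMap_ne_zero r.denom_ne_zero)
  refine ⟨r.num, r.denom, r.isCoprime_num_denom, extensionDegree_eq_max_natDegree _ hr,
    fun P hP ↦ ?_⟩
  match P, hP with
  | .zero, hP => exact absurd rfl hP
  | .some x y h, _ =>
    have h2 : φ.toHom (.some x y h) ≠ 0 → aeval x r.num =
        (φ.toHom (.some x y h)).xCoord * aeval x r.denom := fun h0 ↦ by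
      simpa using φ.aevalAeval_eq hgd h h0
    refine ⟨⟨fun h0 ↦ by simpa using φ.aevalAeval_eq_zero hgd h h0, fun h0 ↦ ?_⟩, h2⟩
    by_contra hne
    have h3 := h2 hne
    rw [Affine.Point.xCoord_some] at h0
    rw [h0, mul_zero] at h3
    obtain ⟨s, t, hst⟩ := r.isCoprime_num_denom
    have := congrArg (aeval x) hst
    simp [h0, h3] at this

end Isogeny

end WeierstrassCurve

/-! ### Counting the kernel through a separable fibre -/

namespace WeierstrassCurve

section Pencil

variable {K : Type*} [Field K]

lemma aeval_ne_zero_of_isCoprime {A : Type*} [CommRing A] [Nontrivial A] [Algebra K A]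
    {u w : K[X]} (h : IsCoprime u w) {x c : A} (hx : aeval x u = c * aeval x w) :
    aeval x w ≠ 0 := by
  intro h0
  obtain ⟨s, t, hst⟩ := h
  have := congrArg (aeval x) hst
  simp [h0, hx] at this

/-- If `u'w = uw'`, coprimality gives `u ∣ u'` and `w ∣ w'`, so both derivatives vanish for degree
reasons. But one of `u`, `w` has degree `ℓ`, which is invertible in `K`. -/
lemma wronskian_ne_zero {u w : K[X]} (h : IsCoprime u w) {ℓ : ℕ} (hℓ : (ℓ : K) ≠ 0)
    (hdeg : max u.natDegree w.natDegree = ℓ) :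
    derivative u * w - u * derivative w ≠ 0 := by
  have key : ∀ q : K[X], q.natDegree = ℓ → derivative q ≠ 0 := fun q hq h0 ↦ by
    have hl : ℓ ≠ 0 := by rintro rfl; simp at hℓ
    have := congrArg (coeff · (ℓ - 1)) h0
    simp only [coeff_derivative, coeff_zero, Nat.sub_add_cancel (Nat.pos_of_ne_zero hl)] at this
    rw [← Nat.cast_succ, Nat.succ_eq_add_one, Nat.sub_add_cancel (Nat.pos_of_ne_zero hl)] at this
    rcases mul_eq_zero.mp this with h | h
    · rw [← hq, coeff_natDegree, leadingCoeff_eq_zero] at h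
      rw [h, natDegree_zero] at hq
      exact hl hq.symm
    · exact hℓ h
  have key2 : ∀ {q r : K[X]}, IsCoprime q r → derivative q * r = q * derivative r →
      derivative q = 0 := fun {q r} hc he ↦ by
    by_contra h0
    have hdvd : q ∣ derivative q := hc.dvd_of_dvd_mul_right ⟨_, he⟩
    have hq0 : q.natDegree ≠ 0 := fun hq ↦ h0 (derivative_of_natDegree_zero hq)
    have := natDegree_le_of_dvd hdvd h0
    have := natDegree_derivative_lt hq0
    omega
  intro h0
  have hu := key2 h (sub_eq_zero.mp h0)
  have hw := key2 h.symm (by linear_combination -h0)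
  rcases max_choice u.natDegree w.natDegree with hm | hm
  · exact key u (hm.symm.trans hdeg) hu
  · exact key w (hm.symm.trans hdeg) hw

/-- All but finitely many members of a pencil of coprime polynomials of degree `ℓ` are separable of
degree `ℓ`. -/
lemma exists_separable_sub_C_mul [Infinite K] {u w : K[X]} (h : IsCoprime u w) {ℓ : ℕ}
    (hℓ : (ℓ : K) ≠ 0) (hdeg : max u.natDegree w.natDegree = ℓ) {q : K[X]} (hq : q ≠ 0) :
    ∃ c : K, q.eval c ≠ 0 ∧ (u - C c * w).natDegree = ℓ ∧ (u - C c * w).Separable := by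
  set W := derivative u * w - u * derivative w with hW
  have hW0 : W ≠ 0 := wronskian_ne_zero h hℓ hdeg
  -- The value of `r` at `c` is the coefficient of degree `ℓ` in `u - cw`.
  set r : K[X] := C (u.coeff ℓ) - C (w.coeff ℓ) * X with hr
  have hr0 : r ≠ 0 := by
    intro hr0
    have h0 : u.coeff ℓ = 0 := by simpa [hr] using congrArg (coeff · 0) hr0
    have h1 : w.coeff ℓ = 0 := by simpa [hr, coeff_C] using congrArg (coeff · 1) hr0
    have hl : ℓ ≠ 0 := by rintro rfl; simp at hℓ
    rcases max_choice u.natDegree w.natDegree with hm | hm <;> rw [hdeg] at hm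
    · rw [hm, coeff_natDegree, leadingCoeff_eq_zero] at h0
      rw [h0, natDegree_zero] at hm
      exact hl hm
    · rw [hm, coeff_natDegree, leadingCoeff_eq_zero] at h1
      rw [h1, natDegree_zero] at hm
      exact hl hm
  -- A multiple root `x` of `u - cw` is a root of the Wronskian, with `c = u(x)/w(x)`; so `S`
  -- contains every bad `c`.
  set S : Set (AlgebraicClosure K) := (fun x ↦ aeval x u / aeval x w) '' W.rootSet _ with hS
  have hfin : (S ∪ (q * r).rootSet (AlgebraicClosure K)).Finite :=
    ((rootSet_finite _ _).image _).union (rootSet_finite _ _)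
  obtain ⟨c, hc⟩ : ∃ c : K, algebraMap K (AlgebraicClosure K) c ∉
      S ∪ (q * r).rootSet (AlgebraicClosure K) := by
    by_contra! hall
    refine (Set.infinite_range_of_injective
      (algebraMap K (AlgebraicClosure K)).injective) (hfin.subset ?_)
    rintro _ ⟨c, rfl⟩
    exact hall c
  rw [Set.mem_union, not_or] at hc
  have hqr : (q * r).eval c ≠ 0 := fun h0 ↦ hc.2 <| by
    rw [mem_rootSet]
    refine ⟨mul_ne_zero hq hr0, ?_⟩
    rw [aeval_algebraMap_apply, coe_aeval_eq_eval, h0, map_zero]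
  rw [eval_mul] at hqr
  refine ⟨c, left_ne_zero_of_mul hqr, ?_, ?_⟩
  · refine natDegree_eq_of_le_of_coeff_ne_zero ?_ ?_
    · refine (natDegree_sub_le _ _).trans (max_le ?_ ?_)
      · exact hdeg ▸ le_max_left _ _
      · exact (natDegree_C_mul_le _ _).trans (hdeg ▸ le_max_right _ _)
    · have := right_ne_zero_of_mul hqr
      rwa [hr, eval_sub, eval_mul, eval_C, eval_C, eval_X, mul_comm, ← coeff_C_mul,
        ← coeff_sub] at this
  · refine (isCoprime_iff_aeval_ne_zero_of_isAlgClosed K (AlgebraicClosure K) _ _).mpr fun x ↦ ?_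
    by_contra! hx
    obtain ⟨hx, hx'⟩ := hx
    simp only [derivative_C_mul, map_sub, map_mul, aeval_C, sub_eq_zero] at hx hx'
    have hwx := aeval_ne_zero_of_isCoprime h hx
    refine hc.1 ⟨x, ?_, by simp only [hx]; field_simp⟩
    rw [mem_rootSet]
    refine ⟨hW0, ?_⟩
    simp only [hW, map_sub, map_mul, hx, hx']
    ring

end Pencil

section Kernel

variable {K : Type*} [Field K] {E E' : WeierstrassCurve K}

lemma isSeparable_of_aeval_eq_zero {A : Type*} [Field A] [Algebra K A] {q : K[X]}
    (hq : q.Separable) {x : A} (hx : aeval x q = 0) : IsSeparable K x :=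
  hq.of_dvd (minpoly.dvd K x hx)

variable (E) in
/-- The points with separable `x`-coordinate which are not `2`-torsion have separable
`y`-coordinate. -/
lemma isSeparable_y {x y : AlgebraicClosure K} (hx : IsSeparable K x)
    (h : (E.baseChange (AlgebraicClosure K)).toAffine.Equation x y)
    (hy : y ≠ (E.baseChange (AlgebraicClosure K)).toAffine.negY x y) : IsSeparable K y := by
  set M := separableClosure K (AlgebraicClosure K)
  let x' : M := ⟨x, hx⟩
  set q : M[X] := X ^ 2 + C ((E.baseChange M).a₁ * x' + (E.baseChange M).a₃) * X -
    C (x' ^ 3 + (E.baseChange M).a₂ * x' ^ 2 + (E.baseChange M).a₄ * x' +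
      (E.baseChange M).a₆) with hq
  have hfac : q.map (algebraMap M (AlgebraicClosure K)) = (X - C y) *
      (X - C ((E.baseChange (AlgebraicClosure K)).toAffine.negY x y)) := by
    have hM : ∀ a : K, algebraMap M (AlgebraicClosure K) (algebraMap K M a) =
      algebraMap K _ a := fun a ↦ (IsScalarTower.algebraMap_apply K M _ a).symm
    have hxx : algebraMap M (AlgebraicClosure K) x' = x := rfl
    rw [Affine.equation_iff] at h
    simp only [baseChange, map_a₁, map_a₂, map_a₃, map_a₄, map_a₆] at h
    have hC := congrArg (C (R := AlgebraicClosure K)) h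
    simp only [hq, baseChange, map_a₁, map_a₂, map_a₃, map_a₄, map_a₆, Polynomial.map_add,
      Polynomial.map_sub, Polynomial.map_mul, Polynomial.map_pow, map_X, map_C, hM, hxx, Affine.negY, map_add,
      map_sub, map_mul, map_neg, map_pow] at hC ⊢
    linear_combination hC
  have hsep : q.Separable := by
    rw [← separable_map (algebraMap M (AlgebraicClosure K)), hfac]
    exact separable_X_sub_C.mul separable_X_sub_C (isCoprime_X_sub_C_of_isUnit_sub
      (sub_ne_zero.mpr hy).isUnit)
  have hyM : IsSeparable M y := isSeparable_of_aeval_eq_zero hsep <| by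
    rw [← eval_map_algebraMap, hfac]
    simp
  exact IsSeparable.of_algebra_isSeparable_of_isSeparable K hyM

open scoped Classical in
lemma mem_range_baseChange_separableClosure {x y : AlgebraicClosure K} (hx : IsSeparable K x)
    (hy : IsSeparable K y)
    (h : (E.baseChange (AlgebraicClosure K)).toAffine.Nonsingular x y) :
    Affine.Point.some x y h ∈ (Affine.Point.baseChange (W' := E)
      (separableClosure K (AlgebraicClosure K)) (AlgebraicClosure K)).range := by
  refine ⟨.some ⟨x, hx⟩ ⟨y, hy⟩ ?_, rfl⟩
  exact (E.toAffine.baseChange_nonsingular (f := Algebra.ofId (separableClosure K (AlgebraicClosure K))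
    (AlgebraicClosure K)) (algebraMap (separableClosure K (AlgebraicClosure K)) _).injective
    ⟨x, hx⟩ ⟨y, hy⟩).mp h

open scoped Classical in
/-- The kernel of an isogeny of degree prime to the characteristic has as many geometric points as
the degree, all of them defined over the separable closure. -/
theorem card_ker_and_ker_le [Infinite K] [E.IsElliptic] [E'.IsElliptic]
    (Φ : (E.baseChange (AlgebraicClosure K)).toAffine.Point →+
      (E'.baseChange (AlgebraicClosure K)).toAffine.Point)
    {u w : K[X]} (h : IsCoprime u w) {ℓ : ℕ} (hℓ : (ℓ : K) ≠ 0)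
    (hdeg : max u.natDegree w.natDegree = ℓ)
    (hΦ : ∀ P, P ≠ 0 → (Φ P = 0 ↔ aeval P.xCoord w = 0) ∧
      (Φ P ≠ 0 → aeval P.xCoord u = (Φ P).xCoord * aeval P.xCoord w)) :
    Nat.card Φ.ker = ℓ ∧ Φ.ker ≤ (Affine.Point.baseChange (W' := E)
      (separableClosure K (AlgebraicClosure K)) (AlgebraicClosure K)).range := by
  -- Instead of the kernel, where `P` and `-P` share an `x`-coordinate, the proof counts the fibre
  -- over a point `Q` with `x(Q) = c` and `Q ≠ -Q`. On that fibre `x` is a bijection onto the `ℓ`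
  -- roots of `q`.
  obtain ⟨c, hc, hcdeg, hcsep⟩ :=
    exists_separable_sub_C_mul h hℓ hdeg E'.Ψ₂Sq_ne_zero_of_isElliptic
  set q := u - C c * w with hq
  set cc := algebraMap K (AlgebraicClosure K) c with hcc
  have hqx : ∀ x : AlgebraicClosure K, aeval x q = 0 ↔ aeval x u = cc * aeval x w := fun x ↦ by
    rw [hq, map_sub, map_mul, aeval_C, sub_eq_zero]
  obtain ⟨yQ, hQns⟩ := (E'.baseChange (AlgebraicClosure K)).exists_nonsingular cc
  set Q : (E'.baseChange (AlgebraicClosure K)).toAffine.Point := .some cc yQ hQns with hQdef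
  have hQ0 : Q ≠ 0 := Affine.Point.some_ne_zero _
  have hQneg : Q ≠ -Q := by
    rw [Ne, eq_neg_iff_add_eq_zero, Affine.Point.add_self_eq_zero_iff hQ0]
    intro h0
    refine hc ((algebraMap K (AlgebraicClosure K)).injective ?_)
    rw [map_zero, eval_Ψ₂Sq, ← twoDiv_map]
    exact h0
  have hfib : ∀ P, Φ P = Q → P ≠ 0 ∧ aeval P.xCoord q = 0 := fun P hP ↦ by
    have hP0 : P ≠ 0 := by rintro rfl; exact hQ0 (by rw [← hP, map_zero])
    refine ⟨hP0, ?_⟩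
    rw [hqx, (hΦ P hP0).2 (hP ▸ hQ0), hP]
    rfl
  have hex : ∀ x, aeval x q = 0 → ∃ P, Φ P = Q ∧ P.xCoord = x := fun x hx ↦ by
    obtain ⟨y, hy⟩ := (E.baseChange (AlgebraicClosure K)).exists_nonsingular x
    rw [hqx] at hx
    have hw := aeval_ne_zero_of_isCoprime h hx
    have hP0 : (Affine.Point.some x y hy) ≠ 0 := Affine.Point.some_ne_zero _
    have hΦP : Φ (.some x y hy) ≠ 0 := fun h0 ↦ hw (((hΦ _ hP0).1).mp h0)
    have h2 := (hΦ _ hP0).2 hΦP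
    rw [Affine.Point.xCoord_some, hx] at h2
    have h3 := mul_right_cancel₀ hw h2
    rcases Affine.Point.eq_or_eq_neg_of_xCoord_eq hΦP hQ0 (h3.symm) with h4 | h4
    · exact ⟨_, h4, rfl⟩
    · exact ⟨-.some x y hy, by rw [map_neg, h4, neg_neg], by rw [Affine.Point.xCoord_neg]; rfl⟩
  have hneg : ∀ P, Φ P = Q → P ≠ -P := fun P hP h0 ↦
    hQneg (by rw [← hP, ← map_neg, ← h0])
  have hinj : ∀ P P', Φ P = Q → Φ P' = Q → P.xCoord = P'.xCoord → P = P' :=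
      fun P P' hP hP' hx ↦ by
    rcases Affine.Point.eq_or_eq_neg_of_xCoord_eq (hfib P hP).1 (hfib P' hP').1 hx with h1 | h1
    · exact h1
    · exact absurd (hP.symm.trans (by rw [h1, map_neg, hP'])) hQneg
  have hq0 : q ≠ 0 := hcsep.ne_zero
  have hcard : Nat.card {P // Φ P = Q} = ℓ := by
    rw [← hcdeg, ← card_rootSet_eq_natDegree (K := AlgebraicClosure K) hcsep
      (IsAlgClosed.splits _), ← Nat.card_eq_fintype_card]
    refine Nat.card_congr (Equiv.ofBijective
      (fun P ↦ ⟨P.1.xCoord, mem_rootSet.mpr ⟨hq0, (hfib P.1 P.2).2⟩⟩) ⟨?_, ?_⟩)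
    · rintro ⟨P, hP⟩ ⟨P', hP'⟩ hPP'
      exact Subtype.ext (hinj P P' hP hP' (congrArg Subtype.val hPP'))
    · rintro ⟨x, hx⟩
      obtain ⟨P, hP, hPx⟩ := hex x (mem_rootSet.mp hx).2
      exact ⟨⟨P, hP⟩, Subtype.ext hPx⟩
  have hℓ0 : ℓ ≠ 0 := by rintro rfl; simp at hℓ
  obtain ⟨P₀, hP₀⟩ : Nonempty {P // Φ P = Q} := by
    by_contra hne
    rw [not_nonempty_iff] at hne
    exact hℓ0 (by rw [← hcard, Nat.card_of_isEmpty])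
  have hmem : ∀ P, Φ P = Q → P ∈ (Affine.Point.baseChange (W' := E)
      (separableClosure K (AlgebraicClosure K)) (AlgebraicClosure K)).range := fun P hP ↦ by
    have h1 := hfib P hP
    have h2 := hneg P hP
    match P, h1, h2 with
    | .zero, h1, _ => exact absurd rfl h1.1
    | .some x y hxy, h1, h2 =>
      have hx := isSeparable_of_aeval_eq_zero hcsep h1.2
      refine mem_range_baseChange_separableClosure hx (E.isSeparable_y hx hxy.1 fun hy ↦ h2 ?_) hxy
      rw [Affine.Point.neg_some, Affine.Point.some.injEq]
      exact ⟨rfl, hy⟩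
  refine ⟨?_, fun T hT ↦ ?_⟩
  · rw [← hcard]
    exact Nat.card_congr
      { toFun := fun T ↦ ⟨T.1 + P₀, by rw [map_add, T.2, zero_add, hP₀]⟩
        invFun := fun P ↦ ⟨P.1 - P₀, by rw [AddMonoidHom.mem_ker, map_sub, P.2, hP₀, sub_self]⟩
        left_inv := fun T ↦ Subtype.ext (add_sub_cancel_right _ _)
        right_inv := fun P ↦ Subtype.ext (sub_add_cancel _ _) }
  -- A kernel point is a difference of two fibre points, and these are separable.
  · rw [← add_sub_cancel_right T P₀]
    refine sub_mem (hmem _ ?_) (hmem _ hP₀)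
    rw [map_add, hT, zero_add, hP₀]

end Kernel

end WeierstrassCurve

/-! ### Galois descent and transfer of valuations -/

namespace WeierstrassCurve

open IsLocalRing

section Descent

variable {K : Type*} [Field K] {E : WeierstrassCurve K}

/-- A separable element fixed by all automorphisms of the algebraic closure is rational. -/
lemma mem_range_of_isSeparable_of_fixed {x : AlgebraicClosure K} (hx : IsSeparable K x)
    (hfix : ∀ σ : AlgebraicClosure K ≃ₐ[K] AlgebraicClosure K, σ x = x) :
    x ∈ (algebraMap K (AlgebraicClosure K)).range := by
  by_contra h
  obtain ⟨y, hne, hy⟩ := (notMem_iff_exists_ne_and_isConjRoot hx (IsAlgClosed.splits _)).mp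
    (show x ∉ (⊥ : Subalgebra K (AlgebraicClosure K)) from fun h' ↦ h (Algebra.mem_bot.mp h'))
  obtain ⟨σ, rfl⟩ := isConjRoot_iff_exists_algEquiv.mp hy
  exact hne (σ.injective (hfix σ))

open scoped Classical in
/-- The product of a rational function over separable roots of a rational polynomial is rational. -/
lemma prod_aroots_mem_range (w a b : K[X])
    (hw : ∀ s ∈ w.aroots (AlgebraicClosure K), IsSeparable K s) :
    ∏ s ∈ (w.aroots (AlgebraicClosure K)).toFinset, aeval s a / aeval s b ∈
      (algebraMap K (AlgebraicClosure K)).range := by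
  refine mem_range_of_isSeparable_of_fixed ?_ fun σ ↦ ?_
  · refine (prod_mem fun s hs ↦ ?_ : _ ∈ separableClosure K (AlgebraicClosure K))
    have hs' := hw s (Multiset.mem_toFinset.mp hs)
    have key : ∀ q : K[X], aeval s q ∈ separableClosure K (AlgebraicClosure K) := fun q ↦ by
      have : aeval s q = algebraMap (separableClosure K (AlgebraicClosure K)) _
          (aeval (⟨s, hs'⟩ : separableClosure K (AlgebraicClosure K)) q) := by
        rw [← aeval_algebraMap_apply]
        rfl
      rw [this]
      exact SetLike.coe_mem _
    exact div_mem (key a) (key b)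
  · rw [map_prod]
    refine Finset.prod_nbij' σ σ.symm ?_ ?_ (fun s _ ↦ σ.symm_apply_apply s)
      (fun s _ ↦ σ.apply_symm_apply s) fun s _ ↦ ?_
    · intro s hs
      rw [Multiset.mem_toFinset, mem_aroots] at hs ⊢
      exact ⟨hs.1, by rw [aeval_algEquiv]; simp [hs.2]⟩
    · intro s hs
      rw [Multiset.mem_toFinset, mem_aroots] at hs ⊢
      exact ⟨hs.1, by rw [aeval_algEquiv]; simp [hs.2]⟩
    · rw [map_div₀, aeval_algEquiv]
      rfl

open scoped Classical in
/-- The number of `x`-coordinates of nonzero points in a finite group of odd order. -/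
lemma two_mul_card_xCoord {F : Type*} [Field F] {W : WeierstrassCurve F}
    (G : AddSubgroup W.toAffine.Point) {ℓ : ℕ} (hG : Nat.card G = ℓ) (hodd : Odd ℓ)
    (S : Finset F) (hS : ∀ s, s ∈ S ↔ ∃ P ∈ G, P ≠ 0 ∧ P.xCoord = s) : 2 * S.card = ℓ - 1 := by
  have hfin : Finite G := Nat.finite_of_card_ne_zero (by rw [hG]; rintro rfl; simp at hodd)
  have hGf : (G : Set W.toAffine.Point).Finite := Set.toFinite _
  set T := hGf.toFinset.erase 0 with hT
  have hmem : ∀ P, P ∈ T ↔ P ≠ 0 ∧ P ∈ G := fun P ↦ by simp [hT]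
  have hTc : T.card = ℓ - 1 := by
    rw [hT, Finset.card_erase_of_mem (by simp [G.zero_mem]), ← hG, ← Set.ncard_eq_toFinset_card _ hGf,
      ← Nat.card_coe_set_eq]
    rfl
  have hmaps : Set.MapsTo (fun P ↦ P.xCoord) (T : Set W.toAffine.Point) S := fun P hP ↦ by
    rw [Finset.mem_coe, hmem] at hP
    exact (hS _).mpr ⟨P, hP.2, hP.1, rfl⟩
  rw [← hTc, Finset.card_eq_sum_card_fiberwise hmaps, Finset.sum_const_nat (m := 2), mul_comm]
  intro s hs
  obtain ⟨P, hPG, hP0, rfl⟩ := (hS s).mp hs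
  have : {Q ∈ T | Q.xCoord = P.xCoord} = {P, -P} := by
    ext Q
    simp only [Finset.mem_filter, hmem, Finset.mem_insert, Finset.mem_singleton]
    refine ⟨fun h ↦ Affine.Point.eq_or_eq_neg_of_xCoord_eq h.1.1 hP0 h.2, ?_⟩
    rintro (rfl | rfl)
    · exact ⟨⟨hP0, hPG⟩, rfl⟩
    · exact ⟨⟨neg_ne_zero.mpr hP0, neg_mem hPG⟩, Affine.Point.xCoord_neg P⟩
  -- It remains that `P ≠ -P`: the group has odd order, so it has no 2-torsion.
  rw [this, Finset.card_pair]
  intro h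
  have h2 : 2 • (⟨P, hPG⟩ : G) = 0 := by
    apply Subtype.ext
    rw [two_nsmul]
    exact eq_neg_iff_add_eq_zero.mp h
  have hℓ : ℓ • (⟨P, hPG⟩ : G) = 0 := by
    rw [← hG]
    exact card_nsmul_eq_zero'
  obtain ⟨k, rfl⟩ := hodd
  rw [add_nsmul, mul_comm, mul_nsmul', h2, nsmul_zero, zero_add, one_nsmul] at hℓ
  exact hP0 (congrArg Subtype.val hℓ)

end Descent

section GoodReduction

variable {R : Type*} [CommRing R] [IsDomain R] [IsDiscreteValuationRing R]
  {K : Type*} [Field K] [Algebra R K] [IsFractionRing R K]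

lemma valuation_maximalIdeal_eq_one_of_isUnit {r : R} (hr : IsUnit r) :
    (IsDiscreteValuationRing.maximalIdeal R).valuation K (algebraMap R K r) = 1 := by
  refine le_antisymm (IsDedekindDomain.HeightOneSpectrum.valuation_le_one _ r) (not_lt.mp ?_)
  rw [IsDedekindDomain.HeightOneSpectrum.valuation_lt_one_iff_mem]
  exact fun h ↦ (mem_maximalIdeal r).mp h hr

lemma isUnit_of_valuation_maximalIdeal_eq_one {r : R}
    (hr : (IsDiscreteValuationRing.maximalIdeal R).valuation K (algebraMap R K r) = 1) :
    IsUnit r := by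
  by_contra h
  exact hr.not_lt ((IsDedekindDomain.HeightOneSpectrum.valuation_lt_one_iff_mem _ r).mpr
    ((mem_maximalIdeal r).mpr h))

/-- A valuation ring dominating `R` induces the normalized valuation on `K`. -/
lemma valuation_eq_one_of_dominates {F : Type*} [Field F] [Algebra K F] (O : ValuationSubring F)
    (f : R →+* O) [IsLocalHom f] (hf : ∀ r, (f r : F) = algebraMap K F (algebraMap R K r)) {a : K}
    (ha : O.valuation (algebraMap K F a) = 1) :
    (IsDiscreteValuationRing.maximalIdeal R).valuation K a = 1 := by
  have key : ∀ r : R, O.valuation (algebraMap K F (algebraMap R K r)) = 1 →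
      (IsDiscreteValuationRing.maximalIdeal R).valuation K (algebraMap R K r) = 1 := fun r hr ↦ by
    rw [← hf, ← O.valuation_eq_one_iff] at hr
    exact valuation_maximalIdeal_eq_one_of_isUnit (isUnit_of_map_unit f r hr)
  rcases ValuationRing.isInteger_or_isInteger R a with ⟨r, hr⟩ | ⟨r, hr⟩
  · rw [← hr] at ha ⊢
    exact key r ha
  · have := key r (by rw [hr, map_inv₀, map_inv₀, ha, inv_one])
    rwa [hr, map_inv₀, inv_eq_one] at this

end GoodReduction

section PotentiallyGoodReduction

variable {R : Type*} [CommRing R] {K : Type*} [Field K] [Algebra R K]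

/-- A curve with potentially good reduction has a model with good reduction over every valuation
ring of the algebraic closure dominating `R`. -/
lemma HasPotentiallyGoodReduction.exists_variableChange {E : WeierstrassCurve K}
    (hE : E.HasPotentiallyGoodReduction R) (O : ValuationSubring (AlgebraicClosure K))
    (f : R →+* O)
    (hf : ∀ r, (f r : AlgebraicClosure K) = algebraMap K _ (algebraMap R K r)) :
    ∃ C : VariableChange (AlgebraicClosure K),
      IsIntegral O (C • E.baseChange (AlgebraicClosure K)) ∧
      O.valuation (C • E.baseChange (AlgebraicClosure K)).Δ = 1 := by
  obtain ⟨L, _, _, _, C, hC⟩ := hE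
  have hint : IsIntegral (integralClosure R L) (C • E.baseChange L) :=
    have := hC.toIsMinimal
    inferInstance
  obtain ⟨V, hV⟩ := hint.integral
  set ψ : L →+* AlgebraicClosure K := algebraMap L (AlgebraicClosure K) with hψ
  -- A valuation ring is integrally closed, so `O` contains everything integral over the image of
  -- `R`.
  have hmem : ∀ s : integralClosure R L, ψ s ∈ O := fun s ↦ by
    have hint : _root_.IsIntegral O (ψ s) := IsIntegral.map_of_comp_eq f ψ (RingHom.ext fun r ↦ by
      rw [RingHom.comp_apply, RingHom.comp_apply, hψ, IsScalarTower.algebraMap_apply R K L,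
        ← IsScalarTower.algebraMap_apply K L]
      exact hf r) s.2
    obtain ⟨y, hy⟩ := IsIntegrallyClosed.isIntegral_iff.mp hint
    rw [← hy]
    exact y.2
  set g : integralClosure R L →+* O :=
    (ψ.comp (integralClosure R L).val.toRingHom).codRestrict O.toSubring hmem with hg
  have hgψ : (algebraMap O (AlgebraicClosure K)).comp g =
      ψ.comp (algebraMap (integralClosure R L) L) := rfl
  have hmodel : C.map ψ • E.baseChange (AlgebraicClosure K) = (V.map g)⁄(AlgebraicClosure K) := by
    have h1 : E.baseChange (AlgebraicClosure K) = (E.baseChange L).map ψ := by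
      rw [baseChange, baseChange, map_map]
      rfl
    rw [h1, map_variableChange, hV, baseChange, baseChange, map_map, map_map, hgψ]
  refine ⟨C.map ψ, ⟨V.map g, hmodel⟩, ?_⟩
  have hΔ : IsUnit V.Δ := by
    have := hC.goodReduction
    rw [hV, baseChange, map_Δ] at this
    exact isUnit_of_valuation_maximalIdeal_eq_one this
  rw [hmodel, baseChange, map_Δ, map_Δ]
  exact (O.valuation_eq_one_iff _).mp (hΔ.map g)

end PotentiallyGoodReduction

end WeierstrassCurve

/-! ### The discriminant and the main theorem -/

namespace WeierstrassCurve

open IsLocalRing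

section Discriminant

variable {R : Type*} [CommRing R] [IsDomain R] [IsDiscreteValuationRing R]
  {K : Type*} [Field K] [Algebra R K] [IsFractionRing R K]

-- Needed to pick a good member of the pencil over `K`; a finite domain is a field, which `R` is
-- not.
variable (R K) in
include R in
lemma infinite_fractionRing : Infinite K := by
  by_contra h
  rw [not_infinite_iff_finite] at h
  have : Finite R := Finite.of_injective _ (IsFractionRing.injective R K)
  exact IsDiscreteValuationRing.not_isField R (Finite.isField_of_domain R)

/-- For an elliptic curve with potentially good reduction over the fraction field of a discrete
valuation ring and an isogeny of prime degree `ℓ > 3` prime to the residue characteristic, the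
discriminant to the power `(ℓ - 1) / 2` is, up to a unit, the sixth power of an element of the
field. -/
theorem exists_valuation_pow_eq {p : ℕ} (hp : p.Prime) [CharP (ResidueField R) p]
    {E E' : WeierstrassCurve K} [E.IsElliptic] [E'.IsElliptic]
    (hE : E.HasPotentiallyGoodReduction R) {ℓ : ℕ} (hℓ : ℓ.Prime) (hℓ3 : 3 < ℓ) (hℓp : ℓ ≠ p)
    (φ : Isogeny E E') (hφ : φ.degree = ℓ) :
    ∃ (n : ℕ) (N : K), 2 * n = ℓ - 1 ∧ N ≠ 0 ∧
      (IsDiscreteValuationRing.maximalIdeal R).valuation K N ^ 6 =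
        (IsDiscreteValuationRing.maximalIdeal R).valuation K E.Δ ^ n := by
  classical
  have hinf : Infinite K := infinite_fractionRing R K
  have hℓK : (ℓ : K) ≠ 0 := fun h ↦ by
    have hR : (ℓ : R) = 0 := IsFractionRing.injective R K (by simpa using h)
    have hres := congrArg (residue R) hR
    rw [map_natCast, map_zero, CharP.cast_eq_zero_iff _ p, Nat.prime_dvd_prime_iff_eq hp hℓ] at hres
    exact hℓp hres.symm
  obtain ⟨u, w, huw, hdeg, hΦ⟩ := φ.exists_isCoprime_xCoord
  rw [hφ] at hdeg
  obtain ⟨hcard, hker⟩ := card_ker_and_ker_le φ.toHom huw hℓK hdeg.symm hΦ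
  have hw0 : w ≠ 0 := by
    rintro rfl
    rw [isCoprime_zero_right] at huw
    rw [natDegree_eq_zero_of_isUnit huw] at hdeg
    simp at hdeg
    omega
  have hS : ∀ s, s ∈ (w.aroots (AlgebraicClosure K)).toFinset ↔
      ∃ P ∈ φ.toHom.ker, P ≠ 0 ∧ P.xCoord = s := fun s ↦ by
    rw [Multiset.mem_toFinset, mem_aroots]
    constructor
    · rintro ⟨-, hs⟩
      obtain ⟨y, hy⟩ := (E.baseChange (AlgebraicClosure K)).exists_nonsingular s
      have h0 : Affine.Point.some s y hy ≠ 0 := Affine.Point.some_ne_zero _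
      exact ⟨.some s y hy, (hΦ _ h0).1.mpr hs, h0, rfl⟩
    · rintro ⟨P, hP, hP0, rfl⟩
      exact ⟨hw0, (hΦ P hP0).1.mp hP⟩
  have hSsep : ∀ s ∈ w.aroots (AlgebraicClosure K), IsSeparable K s := fun s hs ↦ by
    obtain ⟨P, hP, hP0, rfl⟩ := (hS s).mp (Multiset.mem_toFinset.mpr hs)
    obtain ⟨P', rfl⟩ := hker hP
    match P', hP0 with
    | .zero, hP0 => exact absurd rfl hP0
    | .some x y h, _ => exact x.2
  obtain ⟨N, hN⟩ := prod_aroots_mem_range w E.Ψ₃ E.Ψ₂Sq hSsep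
  obtain ⟨O, hfO, hfloc⟩ := exists_factor_valuationRing
    ((algebraMap K (AlgebraicClosure K)).comp (algebraMap R K))
  set f : R →+* O := RingHom.codRestrict _ O.toSubring hfO with hf
  have hfr : ∀ r, (f r : AlgebraicClosure K) = algebraMap K _ (algebraMap R K r) := fun r ↦ rfl
  obtain ⟨C, hCint, hCΔ⟩ := hE.exists_variableChange O f hfr
  -- As `R → O` is local, `p` is a nonunit of `O` because it is one of `R`.
  have hchar : CharP (ResidueField O) p := by
    rw [CharP.charP_iff_prime_eq_zero hp, ← map_natCast (residue O), residue_eq_zero_iff,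
      mem_maximalIdeal, mem_nonunits_iff, ← map_natCast f, isUnit_map_iff f,
      ← mem_nonunits_iff, ← mem_maximalIdeal, ← residue_eq_zero_iff, map_natCast]
    exact CharP.cast_eq_zero _ p
  set S := (w.aroots (AlgebraicClosure K)).toFinset with hSdef
  have hterm : ∀ s ∈ S, O.valuation ((aeval s E.Ψ₃ / aeval s E.Ψ₂Sq) ^ 6) =
      O.valuation (algebraMap K (AlgebraicClosure K) E.Δ) := fun s hs ↦ by
    obtain ⟨P, hP, hP0, rfl⟩ := (hS s).mp hs
    have hℓP : ℓ • P = 0 := by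
      have : ℓ • (⟨P, hP⟩ : φ.toHom.ker) = 0 := by
        rw [← hcard]
        exact card_nsmul_eq_zero'
      exact congrArg Subtype.val this
    have := Affine.Point.valuation_threeDiv_div_twoDiv O hp hℓ hℓ3 hℓp hCint hCΔ hP0 hℓP
    have hΔ : (E.baseChange (AlgebraicClosure K)).Δ = algebraMap K _ E.Δ := E.map_Δ _
    rw [← hΔ, ← this, E.aeval_Ψ₃, E.aeval_Ψ₂Sq]
  have hΔ0 : E.Δ ≠ 0 := E.isUnit_Δ.ne_zero
  -- The comparison is phrased as a quotient being a unit, since that is what passes from `O` to the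
  -- normalized valuation of `R`.
  have hval : O.valuation (algebraMap K (AlgebraicClosure K) (N ^ 6 / E.Δ ^ S.card)) = 1 := by
    have h6 : O.valuation (algebraMap K (AlgebraicClosure K) N ^ 6) =
        O.valuation (algebraMap K (AlgebraicClosure K) E.Δ) ^ S.card := by
      rw [hN, ← Finset.prod_pow, map_prod, Finset.prod_congr rfl hterm, Finset.prod_const]
    rw [map_div₀, map_pow, map_pow, map_div₀, h6, map_pow, div_self]
    exact pow_ne_zero _ ((Valuation.ne_zero_iff _).mpr ((_root_.map_ne_zero _).mpr hΔ0))
  have hv := valuation_eq_one_of_dominates O f hfr hval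
  have hvΔ : (IsDiscreteValuationRing.maximalIdeal R).valuation K E.Δ ^ S.card ≠ 0 :=
    pow_ne_zero _ ((Valuation.ne_zero_iff _).mpr hΔ0)
  rw [map_div₀, map_pow, map_pow, div_eq_one_iff_eq hvΔ] at hv
  refine ⟨S.card, N, two_mul_card_xCoord _ hcard (hℓ.odd_of_ne_two (by omega)) S hS, ?_, hv⟩
  rintro rfl
  exact hvΔ (by rw [← hv, map_zero, zero_pow (by norm_num)])

end Discriminant

end WeierstrassCurve

end

theorem mainTheorem2
    {R : Type*} [CommRing R] [IsDomain R] [IsDiscreteValuationRing R]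
    [IsAdicComplete (IsLocalRing.maximalIdeal R) R]
    {K : Type*} [Field K] [Algebra R K] [IsFractionRing R K]
    [PerfectField (IsLocalRing.ResidueField R)]
    (p : ℕ) (hp : p.Prime) [CharP (IsLocalRing.ResidueField R) p]
    (E : WeierstrassCurve K) [E.IsElliptic]
    (hE : E.HasPotentiallyGoodReduction R)
    (ℓ : ℕ) (hℓ : ℓ.Prime) (hℓ3 : 3 < ℓ) (hℓp : ℓ ≠ p)
    (E' : WeierstrassCurve K) [E'.IsElliptic]
    (φ : WeierstrassCurve.Isogeny E E') (hφ : φ.degree = ℓ)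
    (C : WeierstrassCurve.VariableChange K) (hC : (C • E).IsMinimal R) :
    (12 : ℤ) ∣ ((ℓ : ℤ) - 1) * (C • E).valΔ R := by
  obtain ⟨n, N, hn, hN, h⟩ :=
    WeierstrassCurve.exists_valuation_pow_eq hp hE hℓ hℓ3 hℓp φ hφ
  have hlog := congrArg WithZero.log h
  rw [WithZero.log_pow, WithZero.log_pow, nsmul_eq_mul, nsmul_eq_mul] at hlog
  have hn' : (ℓ : ℤ) - 1 = 2 * n := by
    have := hℓ.one_lt
    omega
  rw [WeierstrassCurve.valΔ, WeierstrassCurve.variableChange_Δ, map_mul, map_pow,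
    WithZero.log_mul (pow_ne_zero _ ((Valuation.ne_zero_iff _).mpr C.u⁻¹.ne_zero))
      ((Valuation.ne_zero_iff _).mpr E.isUnit_Δ.ne_zero), WithZero.log_pow, nsmul_eq_mul, hn']
  -- The discriminant of the new equation is `u⁻¹² Δ`: the first term accounts for `u⁻¹²`, and the
  -- second for `2n v(Δ) = 12 v(N)`.
  refine ⟨-(2 * n * WithZero.log ((IsDiscreteValuationRing.maximalIdeal R).valuation K
    (C.u⁻¹ : Kˣ))) - WithZero.log ((IsDiscreteValuationRing.maximalIdeal R).valuation K N), ?_⟩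
  push_cast at hlog ⊢
  linear_combination 2 * hlog
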